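/- Let $a>b>0$ and let $\mathcal E$ be the ellipse $x^2/a^2+y^2/b^2=1$. Let $\mathcal K$ be a circle with center $C$, and let $\mathcal T$ be the family of all triangles inscribed in $\mathcal E$ whose incircle is $\mathcal K$. Suppose that $\mathcal T$ contains an equilateral triangle (so that $C$ lies on the locus $\mathcal E_\triangle$ of the centroids of the equilateral triangles inscribed in $\mathcal E$). For $T\in\mathcal T$ let $\Gamma$ be the radical axis of the incircle and the circumcircle of $T$ (the line at infinity when $T$ is equilateral). Let $\mathcal L_3$ be the locus over $\mathcal T$ of the circumcenter, and $\mathcal L_{36}$ the locus over the non-equilateral $T\in\mathcal T$ of the inverse of the incenter in the circumcircle. Then $\mathcal T$ has a regular $C^1$ parametrization $u\mapsto T(u)$, $u\in\mathbb R$. Let $G(u,X)$ be the power of the point $X$ with respect to the incircle of $T(u)$ minus its power with respect to the circumcircle of $T(u)$, so that the radical axis of $T(u)$ is $G(u,\cdot)=0$. For every such parametrization the envelope of $\Gamma$, i.e. the set of points $X$ of the plane with $G(u,X)=\partial_u G(u,X)=0$ for some $u$, is one and the same parabola. The locus $\mathcal L_3$ is a noncircular ellipse, and the axis of symmetry of the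 parabola is the major axis of $\mathcal L_3$. Moreover $\mathcal L_{36}$ is a line, and the directrix of the parabola is parallel to it. -/

import Mathlib

open scoped Affine

namespace CircularCaustic

/-- The Euclidean plane. -/
abbrev Plane : Type := EuclideanSpace ℝ (Fin 2)

/-- The ellipse `(x/a)² + (y/b)² = 1`. -/
def outerEllipse (a b : ℝ) : Set Plane :=
  {P | (P 0 / a) ^ 2 + (P 1 / b) ^ 2 = 1}

/-- The triangles inscribed in the ellipse with semiaxes `a, b` whose incircle is the circle with
center `C` and radius `r`. -/
def ponceletFamily (a b : ℝ) (C : Plane) (r : ℝ) : Set (Affine.Triangle ℝ Plane) :=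
  {T | (∀ i, T.points i ∈ outerEllipse a b) ∧ T.insphere = ⟨C, r⟩}

/-- `T` is a regular `C¹` parametrization of the whole one-parameter family `fam` of triangles
(a triangle being covered up to the labelling of its vertices). -/
structure IsRegularParam (fam : Set (Affine.Triangle ℝ Plane))
    (T : ℝ → Affine.Triangle ℝ Plane) : Prop where
  mem : ∀ u, T u ∈ fam
  contDiff : ∀ i, ContDiff ℝ 1 (fun u => (T u).points i)
  regular : ∀ u, ∃ i, deriv (fun v => (T v).points i) u ≠ 0
  covers : ∀ S ∈ fam, ∃ u, Set.range (T u).points = Set.range S.points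

/-- The power of a point with respect to the incircle minus its power with respect to the
circumcircle. It is an affine function of the point, and its zero set is the radical axis of the two
circles. If the circles are concentric (and different), it is a nonzero constant: the radical axis
is then the line at infinity, with no point in the plane. -/
noncomputable def radicalFn (T : Affine.Triangle ℝ Plane) (X : Plane) : ℝ :=
  T.insphere.power X - T.circumsphere.power X

/-- The envelope of the family of curves `G u X = 0`: the points where `G = 0` and `∂G/∂u = 0`
for some value of the parameter `u`. -/
def envelope (G : ℝ → Plane → ℝ) : Set Plane :=
  {X | ∃ u, G u X = 0 ∧ HasDerivAt (fun v => G v X) 0 u}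

/-- A (straight) line of the plane. -/
def IsLine (l : AffineSubspace ℝ Plane) : Prop :=
  (l : Set Plane).Nonempty ∧ Module.finrank ℝ l.direction = 1

/-- `S` is the parabola with focus `F` and directrix `D`. -/
def IsParabola (S : Set Plane) (F : Plane) (D : AffineSubspace ℝ Plane) : Prop :=
  IsLine D ∧ F ∉ D ∧ S = {X | dist X F = Metric.infDist X (D : Set Plane)}

/-- The axis of symmetry of the parabola with focus `F` and directrix `D`: the line through `F`
perpendicular to `D`. -/
noncomputable def parabolaAxis (F : Plane) (D : AffineSubspace ℝ Plane) :
    AffineSubspace ℝ Plane :=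
  AffineSubspace.mk' F D.directionᗮ

/-- `S` is the (noncircular, nondegenerate) ellipse with foci `F ≠ F'` and semi-major axis `s`. Its
major axis is the line `F F'`. -/
def IsEllipse (S : Set Plane) (F F' : Plane) (s : ℝ) : Prop :=
  F ≠ F' ∧ dist F F' < 2 * s ∧ S = {X | dist X F + dist X F' = 2 * s}

/-- The locus of the circumcenter `X₃`. -/
noncomputable def circumcenterLocus (fam : Set (Affine.Triangle ℝ Plane)) : Set Plane :=
  {X | ∃ T ∈ fam, X = T.circumcenter}

/-- The locus of `X₃₆`, the inverse of the incenter in the circumcircle. The inverse does not exist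
where incenter and circumcenter coincide. -/
noncomputable def locusX36 (fam : Set (Affine.Triangle ℝ Plane)) : Set Plane :=
  {X | ∃ T ∈ fam, T.incenter ≠ T.circumcenter ∧
    X = EuclideanGeometry.inversion T.circumcenter T.circumradius T.incenter}

end CircularCaustic

namespace CircularCaustic

open ComplexConjugate

/-! Move the incircle to the unit circle of `ℂ`. With contact points `w₀, w₁, w₂`, the vertices are
the tangent meets `2ab/(a+b)`. Since the ellipse passes through the vertices `-2w` of a regular
circumscribed triangle, it takes the form `|z|² - 4 = 2k Re(z² + 2 μ̄ z)` with `|μ| = 1` and `2k =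
(a² - b²)/(a² + b²) < 1` (`exists_onConic`). For the sum `σ` and the product `m` of the contact
points, being inscribed then means `σ = k(m - μ)` (`sum_eq_of_onConic`, `onConic_of_sum_eq`). As `2k
< 1` forces `|σ| < 1`, the contact triangle is acute and the unit circle is the incircle rather than
an excircle. Every unit `m` occurs (`exists_mul_contactPhase_sq_eq`), so `σ` runs over the whole
circle of radius `k` about `-kμ`, which passes through `0`.

The circumcenter is `-2σ/(1 - |σ|²)`, the circumradius `2/(1 - |σ|²)`, and the radical axis `3 +
|σ|² = 4 Re(z σ̄)`. With `Y = z + kμ/2` the axis reads `Re(m̄ Y) = Re(μ̄ Y) + 3/(4k)`. A regular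
parametrization moves `m` over the whole unit circle with `m' ≠ 0` (`exists_contactProd`), so
stationarity means `Im(m̄ Y) = 0` whatever the parametrization, and the envelope is `|Y| = |Re(μ̄ Y)
+ 3/(4k)|`: a parabola in focus-directrix form (`mem_envelope_iff`).

The circumcenters fill an ellipse of eccentricity `2k` with a vertex at `0` and foci on `ℝμ`
(`norm_add_norm_eq_iff`). The point X₃₆ is `2σ/|σ|²`, and inversion turns the circle of `σ` into the
line `Re(z μ̄) = -1/k`. So both axes are `ℝμ`, and the directrix and this line are perpendicular to
it. -/

theorem conj_eq_inv_of_norm_eq_one {z : ℂ} (hz : ‖z‖ = 1) : conj z = z⁻¹ :=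
  (Complex.inv_eq_conj hz).symm

theorem ne_zero_of_norm_eq_one {z : ℂ} (hz : ‖z‖ = 1) : z ≠ 0 := by
  rintro rfl
  simp at hz

theorem re_sq_add_im_sq {z : ℂ} (hz : ‖z‖ = 1) : z.re * z.re + z.im * z.im = 1 := by
  have h := Complex.normSq_eq_norm_sq z
  rw [hz, Complex.normSq_apply] at h
  linarith

theorem add_ne_zero_of_norm_sum_lt_one {a b c : ℂ} (hc : ‖c‖ = 1) (h : ‖a + b + c‖ < 1) :
    a + b ≠ 0 := by
  intro h0
  rw [h0, zero_add, hc] at h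
  exact lt_irrefl _ h

theorem ne_of_norm_sum_lt_one {a b c : ℂ} (ha : ‖a‖ = 1) (hc : ‖c‖ = 1) (h : ‖a + b + c‖ < 1) :
    a ≠ b := by
  rintro rfl
  have h1 : ‖(2 : ℂ) * a‖ ≤ ‖a + a + c‖ + ‖c‖ := by
    have : (2 : ℂ) * a = (a + a + c) - c := by ring
    rw [this]
    exact norm_sub_le _ _
  rw [norm_mul, ha, hc] at h1
  norm_num at h1
  linarith

theorem one_add_re_mul_conj_pos {a b : ℂ} (ha : ‖a‖ = 1) (hb : ‖b‖ = 1) (h : a + b ≠ 0) :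
    0 < 1 + (a * conj b).re := by
  have h1 : 0 < Complex.normSq (a + b) := Complex.normSq_pos.2 h
  rw [Complex.normSq_add, Complex.normSq_eq_norm_sq, Complex.normSq_eq_norm_sq, ha, hb] at h1
  linarith

theorem re_mul_conj_comm (a b : ℂ) : (a * conj b).re = (b * conj a).re := by
  simp [Complex.mul_re]; ring

/-! ### Tangents of the unit circle and acute contact triangles -/

/-- The intersection of the tangents of the unit circle at `a` and `b`. -/
noncomputable def tangentMeet (a b : ℂ) : ℂ := 2 * a * b / (a + b)

theorem tangentMeet_comm (a b : ℂ) : tangentMeet a b = tangentMeet b a := by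
  unfold tangentMeet
  rw [add_comm a b]; ring

theorem conj_tangentMeet {a b : ℂ} (ha : ‖a‖ = 1) (hb : ‖b‖ = 1) :
    conj (tangentMeet a b) = 2 / (a + b) := by
  have ha0 := ne_zero_of_norm_eq_one ha
  have hb0 := ne_zero_of_norm_eq_one hb
  unfold tangentMeet
  simp only [map_div₀, map_mul, map_add, conj_eq_inv_of_norm_eq_one ha,
    conj_eq_inv_of_norm_eq_one hb, Complex.conj_ofNat]
  by_cases h : a + b = 0
  · have : a⁻¹ + b⁻¹ = 0 := by
      rw [eq_neg_of_add_eq_zero_right h, inv_neg, add_neg_cancel]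
    simp [h, this]
  · have : a⁻¹ + b⁻¹ = (a + b) / (a * b) := by field_simp; ring
    rw [this]
    field_simp

theorem tangentMeet_eq_div {a b : ℂ} (ha : ‖a‖ = 1) (hb : ‖b‖ = 1) (h : a + b ≠ 0) :
    tangentMeet a b = (a + b) / ((1 + (a * conj b).re : ℝ) : ℂ) := by
  have hp := one_add_re_mul_conj_pos ha hb h
  have hp' : ((1 + (a * conj b).re : ℝ) : ℂ) ≠ 0 := by exact_mod_cast hp.ne'
  have ha0 := ne_zero_of_norm_eq_one ha
  have hb0 := ne_zero_of_norm_eq_one hb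
  unfold tangentMeet
  rw [div_eq_div_iff h hp']
  have h2 : (2 : ℂ) * ((1 + (a * conj b).re : ℝ) : ℂ) = 2 + a * b⁻¹ + b * a⁻¹ := by
    push_cast
    rw [mul_add, mul_one, ← conj_eq_inv_of_norm_eq_one ha, ← conj_eq_inv_of_norm_eq_one hb]
    have := Complex.add_conj (a * conj b)
    push_cast at this
    rw [← this]
    simp
    ring
  rw [show 2 * a * b * ((1 + (a * conj b).re : ℝ) : ℂ)
    = a * b * (2 * ((1 + (a * conj b).re : ℝ) : ℂ)) by ring, h2]
  field_simp
  ring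

theorem re_tangentMeet_mul_conj {a b : ℂ} (ha : ‖a‖ = 1) (hb : ‖b‖ = 1) (h : a + b ≠ 0) :
    (tangentMeet a b * conj a).re = 1 := by
  have ha0 := ne_zero_of_norm_eq_one ha
  have h1 : tangentMeet a b * conj a + conj (tangentMeet a b * conj a) = 2 := by
    rw [map_mul, conj_tangentMeet ha hb, Complex.conj_conj, conj_eq_inv_of_norm_eq_one ha]
    unfold tangentMeet
    field_simp
    ring
  rw [Complex.add_conj] at h1
  have : 2 * (tangentMeet a b * conj a).re = 2 := by exact_mod_cast h1
  linarith

theorem eq_tangentMeet {a b z : ℂ} (ha : ‖a‖ = 1) (hb : ‖b‖ = 1) (hab : a ≠ b)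
    (h1 : (z * conj a).re = 1) (h2 : (z * conj b).re = 1) : a + b ≠ 0 ∧ z = tangentMeet a b := by
  have ha0 := ne_zero_of_norm_eq_one ha
  have hb0 := ne_zero_of_norm_eq_one hb
  have hs : a + b ≠ 0 := by
    intro h
    have : b = -a := by linear_combination h
    rw [this] at h2
    simp only [map_neg, mul_neg, Complex.neg_re, h1] at h2
    norm_num at h2
  have key : ∀ c : ℂ, ‖c‖ = 1 → (z * conj c).re = 1 → z + conj z * c ^ 2 = 2 * c := by
    intro c hc h
    have h3 := Complex.add_conj (z * conj c)
    have hc0 := ne_zero_of_norm_eq_one hc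
    rw [h, map_mul, Complex.conj_conj, conj_eq_inv_of_norm_eq_one hc] at h3
    field_simp at h3
    push_cast at h3
    linear_combination h3
  have e1 := key a ha h1
  have e2 := key b hb h2
  have e3 : conj z * (a + b) = 2 :=
    mul_left_cancel₀ (sub_ne_zero.2 hab) (by linear_combination e1 - e2)
  refine ⟨hs, ?_⟩
  unfold tangentMeet
  rw [eq_div_iff hs]
  linear_combination (a + b) * e1 - a ^ 2 * e3

theorem re_tangentMeet_mul_conj_lt_one_iff {a b c : ℂ} (ha : ‖a‖ = 1) (hb : ‖b‖ = 1)
    (h : a + b ≠ 0) :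
    (tangentMeet a b * conj c).re < 1 ↔
      (a * conj c).re + (b * conj c).re < 1 + (a * conj b).re := by
  have hp := one_add_re_mul_conj_pos ha hb h
  rw [tangentMeet_eq_div ha hb h, div_mul_eq_mul_div, Complex.div_ofReal_re, div_lt_one hp,
    add_mul, Complex.add_re]

theorem normSq_sum {a b c : ℂ} (ha : ‖a‖ = 1) (hb : ‖b‖ = 1) (hc : ‖c‖ = 1) :
    ‖a + b + c‖ ^ 2 = 3 + 2 * ((a * conj b).re + (a * conj c).re + (b * conj c).re) := by
  rw [← Complex.normSq_eq_norm_sq, Complex.normSq_add, Complex.normSq_add]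
  simp only [Complex.normSq_eq_norm_sq, ha, hb, hc, add_mul, Complex.add_re]
  ring

/-- `a + b + c` is the orthocenter of the contact triangle, so the left side expresses acuteness.
The cosine form is the one comparable with the tangent inequalities. -/
theorem norm_sum_lt_one_iff {a b c : ℂ} (ha : ‖a‖ = 1) (hb : ‖b‖ = 1) (hc : ‖c‖ = 1) :
    ‖a + b + c‖ < 1 ↔ 1 + ((a * conj b).re + (a * conj c).re + (b * conj c).re) < 0 := by
  have h := normSq_sum ha hb hc
  have hn := norm_nonneg (a + b + c)
  constructor
  · intro h1
    nlinarith
  · intro h1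
    by_contra! h2
    nlinarith

theorem re_tangentMeet_mul_conj_lt_one {a b c : ℂ} (ha : ‖a‖ = 1) (hb : ‖b‖ = 1) (hc : ‖c‖ = 1)
    (h : ‖a + b + c‖ < 1) : (tangentMeet a b * conj c).re < 1 := by
  have hs := add_ne_zero_of_norm_sum_lt_one hc h
  rw [re_tangentMeet_mul_conj_lt_one_iff ha hb hs]
  have := one_add_re_mul_conj_pos ha hb hs
  have := (norm_sum_lt_one_iff ha hb hc).1 h
  linarith

/-- The Gram determinant of three unit vectors of a plane vanishes. -/
theorem gram_eq_zero {a b c : ℂ} (ha : ‖a‖ = 1) (hb : ‖b‖ = 1) (hc : ‖c‖ = 1) :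
    1 + 2 * (a * conj b).re * (a * conj c).re * (b * conj c).re =
      (a * conj b).re ^ 2 + (a * conj c).re ^ 2 + (b * conj c).re ^ 2 := by
  have h1 := re_sq_add_im_sq ha
  have h2 := re_sq_add_im_sq hb
  have h3 := re_sq_add_im_sq hc
  have key : (a.re * a.re + a.im * a.im) * (b.re * b.re + b.im * b.im) *
      (c.re * c.re + c.im * c.im) + 2 * (a * conj b).re * (a * conj c).re * (b * conj c).re =
      (c.re * c.re + c.im * c.im) * (a * conj b).re ^ 2 +
      (b.re * b.re + b.im * b.im) * (a * conj c).re ^ 2 +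
      (a.re * a.re + a.im * a.im) * (b * conj c).re ^ 2 := by
    simp only [Complex.mul_re, Complex.conj_re, Complex.conj_im]
    ring
  rw [h1, h2, h3] at key
  linarith

/-- Let `x, y, z` be the three cosines. The hypotheses make three factors positive; by the Gram
relation their product times `1 + x + y + z` is `-4(1 - x²)(x - yz)² ≤ 0`. Equality `1 + x + y + z =
0` would force `(1+x)(1+y)(1+z) = 0`. -/
theorem norm_sum_lt_one_of_re_tangentMeet {a b c : ℂ} (ha : ‖a‖ = 1) (hb : ‖b‖ = 1) (hc : ‖c‖ = 1)
    (hab : a + b ≠ 0) (hac : a + c ≠ 0) (hbc : b + c ≠ 0)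
    (h1 : (tangentMeet a b * conj c).re < 1) (h2 : (tangentMeet a c * conj b).re < 1)
    (h3 : (tangentMeet b c * conj a).re < 1) : ‖a + b + c‖ < 1 := by
  rw [re_tangentMeet_mul_conj_lt_one_iff ha hb hab] at h1
  rw [re_tangentMeet_mul_conj_lt_one_iff ha hc hac] at h2
  rw [re_tangentMeet_mul_conj_lt_one_iff hb hc hbc] at h3
  rw [norm_sum_lt_one_iff ha hb hc]
  have hg := gram_eq_zero ha hb hc
  have p1 := one_add_re_mul_conj_pos ha hb hab
  have p2 := one_add_re_mul_conj_pos ha hc hac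
  have p3 := one_add_re_mul_conj_pos hb hc hbc
  rw [re_mul_conj_comm c b] at h2
  rw [re_mul_conj_comm b a, re_mul_conj_comm c a] at h3
  set x := (a * conj b).re
  set y := (a * conj c).re
  set z := (b * conj c).re
  have hx : 0 < 1 + x - y - z := by linarith
  have hy : 0 < 1 + y - x - z := by linarith
  have hz : 0 < 1 + z - x - y := by linarith
  have q1 : x ≤ 1 := by
    by_contra! h
    nlinarith
  have prod : (1 + (x + y + z)) * ((1 + x - y - z) * (1 + y - x - z) * (1 + z - x - y)) =
      -4 * (1 - x ^ 2) * (x - y * z) ^ 2 := by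
    have f1 : (1 + (x + y + z)) * (1 + x - y - z) = 2 * (1 + x) * (x - y * z) := by
      linear_combination hg
    have f2 : (1 + y - x - z) * (1 + z - x - y) = -2 * (1 - x) * (x - y * z) := by
      linear_combination hg
    calc _ = ((1 + (x + y + z)) * (1 + x - y - z)) * ((1 + y - x - z) * (1 + z - x - y)) := by ring
      _ = _ := by rw [f1, f2]; ring
  have hle : 1 + (x + y + z) ≤ 0 := by
    by_contra! h
    have : 0 < (1 + (x + y + z)) * ((1 + x - y - z) * (1 + y - x - z) * (1 + z - x - y)) := by
      positivity
    rw [prod] at this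
    have : 0 ≤ (1 - x ^ 2) * (x - y * z) ^ 2 := mul_nonneg (by nlinarith) (sq_nonneg _)
    linarith
  refine lt_of_le_of_ne hle fun h0 => ?_
  have : (1 + x) * ((1 + y) * (1 + z)) = 0 := by
    linear_combination hg / 2 + (1 + (x + y + z)) / 2 * h0
  have : 0 < (1 + x) * ((1 + y) * (1 + z)) := by positivity
  linarith

/-! ### Complex coordinates adapted to the incircle -/

/-- The complex plane as the Euclidean plane. -/
noncomputable def planeIso : ℂ ≃ₗᵢ[ℝ] Plane := Complex.orthonormalBasisOneI.repr

theorem planeIso_apply_zero (z : ℂ) : planeIso z 0 = z.re := by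
  simp [planeIso]

theorem planeIso_apply_one (z : ℂ) : planeIso z 1 = z.im := by
  simp [planeIso]

/-- The complex coordinate with origin `C` and unit length `r`. -/
noncomputable def chart (C : Plane) (r : ℝ) (z : ℂ) : Plane := C + r • planeIso z

theorem chart_apply_zero (C : Plane) (r : ℝ) (z : ℂ) : chart C r z 0 = C 0 + r * z.re := by
  simp [chart, planeIso_apply_zero]

theorem chart_apply_one (C : Plane) (r : ℝ) (z : ℂ) : chart C r z 1 = C 1 + r * z.im := by
  simp [chart, planeIso_apply_one]

theorem chart_zero (C : Plane) (r : ℝ) : chart C r 0 = C := by simp [chart]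

theorem chart_sub_chart (C : Plane) (r : ℝ) (z w : ℂ) :
    chart C r z - chart C r w = r • planeIso (z - w) := by
  simp [chart, smul_sub]

theorem dist_chart {C : Plane} {r : ℝ} (hr : 0 < r) (z w : ℂ) :
    dist (chart C r z) (chart C r w) = r * ‖z - w‖ := by
  rw [dist_eq_norm, chart_sub_chart, norm_smul, LinearIsometryEquiv.norm_map, Real.norm_eq_abs,
    abs_of_pos hr]

theorem chart_surjective {C : Plane} {r : ℝ} (hr : 0 < r) (P : Plane) : ∃ z, chart C r z = P := by
  refine ⟨planeIso.symm (r⁻¹ • (P - C)), ?_⟩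
  rw [chart, LinearIsometryEquiv.apply_symm_apply, smul_smul, mul_inv_cancel₀ hr.ne', one_smul,
    add_sub_cancel]

theorem chart_injective {C : Plane} {r : ℝ} (hr : 0 < r) : Function.Injective (chart C r) := by
  intro z w h
  have := dist_chart (C := C) hr z w
  rw [h, dist_self] at this
  have h2 : ‖z - w‖ = 0 := by
    rcases mul_eq_zero.1 this.symm with h | h
    · exact absurd h hr.ne'
    · exact h
  exact sub_eq_zero.1 (norm_eq_zero.1 h2)

theorem inner_planeIso (z w : ℂ) : inner ℝ (planeIso z) (planeIso w) = (z * conj w).re := by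
  rw [LinearIsometryEquiv.inner_map_map, Complex.inner]
  simp [Complex.mul_re]; ring

theorem affineSpan_triangle (T : Affine.Triangle ℝ Plane) :
    affineSpan ℝ (Set.range T.points) = ⊤ := by
  rw [T.independent.affineSpan_eq_top_iff_card_eq_finrank_add_one]
  simp [Plane]

/-! ### Triangles with a prescribed incircle -/

/-- The vertex, opposite to the side touching at `w i`, of the triangle whose sides touch the unit
circle at `w 0`, `w 1`, `w 2`. -/
noncomputable def contactVertex (w : Fin 3 → ℂ) (i : Fin 3) : ℂ :=
  tangentMeet (w (i + 1)) (w (i + 2))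

/-- `w` is a triple of points of the unit circle which form an acute triangle, as the points of
contact of an incircle do. -/
structure IsContactTriple (w : Fin 3 → ℂ) : Prop where
  norm_eq_one : ∀ i, ‖w i‖ = 1
  norm_sum_lt_one : ‖w 0 + w 1 + w 2‖ < 1

namespace IsContactTriple

variable {w : Fin 3 → ℂ}

theorem norm_sum_lt (h : IsContactTriple w) (i : Fin 3) :
    ‖w (i + 1) + w (i + 2) + w i‖ < 1 := by
  have h0 := h.norm_sum_lt_one
  fin_cases i
  · convert h0 using 2; simp; ring
  · convert h0 using 2; simp; ring
  · exact h0

theorem add_ne_zero (h : IsContactTriple w) (i : Fin 3) : w (i + 1) + w (i + 2) ≠ 0 :=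
  add_ne_zero_of_norm_sum_lt_one (h.norm_eq_one i) (h.norm_sum_lt i)

theorem re_contactVertex_lt (h : IsContactTriple w) (i : Fin 3) :
    (contactVertex w i * conj (w i)).re < 1 :=
  re_tangentMeet_mul_conj_lt_one (h.norm_eq_one _) (h.norm_eq_one _) (h.norm_eq_one _)
    (h.norm_sum_lt i)

theorem re_contactVertex_of_ne (h : IsContactTriple w) {i j : Fin 3} (hij : j ≠ i) :
    (contactVertex w j * conj (w i)).re = 1 := by
  have : i = j + 1 ∨ i = j + 2 := by decide +revert
  rcases this with rfl | rfl
  · exact re_tangentMeet_mul_conj (h.norm_eq_one _) (h.norm_eq_one _) (h.add_ne_zero _)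
  · rw [contactVertex, tangentMeet_comm]
    exact re_tangentMeet_mul_conj (h.norm_eq_one _) (h.norm_eq_one _)
      (by rw [add_comm]; exact h.add_ne_zero _)

end IsContactTriple

/-- Barycentric coordinates and an affine function that is constant on a side. -/
theorem barycentric_mul_eq {z : Fin 3 → ℂ} {w : ℂ} {i : Fin 3}
    (h : ∀ j, j ≠ i → (z j * conj w).re = 1) {l : Fin 3 → ℝ} (hl : ∑ j, l j = 1)
    (h0 : ∑ j, (l j : ℂ) * z j = 0) : l i * (1 - (z i * conj w).re) = 1 := by
  have h1 : ∑ j, l j * (1 - (z j * conj w).re) = 1 := by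
    have h2 : ∑ j, l j * (z j * conj w).re = 0 := by
      have : (∑ j, (l j : ℂ) * z j) * conj w = 0 := by rw [h0, zero_mul]
      rw [Finset.sum_mul] at this
      have := congrArg Complex.re this
      rw [Complex.re_sum] at this
      rw [← Complex.zero_re, ← this]
      refine Finset.sum_congr rfl fun j _ => ?_
      rw [mul_assoc, Complex.re_ofReal_mul]
    simp only [mul_sub, mul_one, Finset.sum_sub_distrib, h2, hl, sub_zero]
  rw [Finset.sum_eq_single i] at h1
  · exact h1
  · intro j _ hj
    rw [h j hj, sub_self, mul_zero]
  · simp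

theorem affineCombination_chart {C : Plane} {r : ℝ} (z : Fin 3 → ℂ) {l : Fin 3 → ℝ}
    (hl : ∑ j, l j = 1) :
    Finset.univ.affineCombination ℝ (fun i => chart C r (z i)) l
      = chart C r (∑ j, (l j : ℂ) * z j) := by
  rw [Finset.affineCombination_eq_linear_combination _ _ _ hl]
  simp only [chart, smul_add, Finset.sum_add_distrib, ← Finset.sum_smul, hl, one_smul, map_sum,
    Finset.smul_sum]
  congr 1
  refine Finset.sum_congr rfl fun j _ => ?_
  rw [← Complex.real_smul, map_smul, smul_comm]

/-- A triangle with prescribed incircle is determined by the points of contact. -/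
theorem exists_contactTriple {C : Plane} {r : ℝ} {T : Affine.Triangle ℝ Plane}
    (hT : T.insphere = ⟨C, r⟩) :
    0 < r ∧ ∃ w, IsContactTriple w ∧ ∀ i, T.points i = chart C r (contactVertex w i) := by
  have hC : T.incenter = C := by rw [← T.insphere_center, hT]
  have hR : T.inradius = r := by rw [← T.insphere_radius, hT]
  have hr : 0 < r := hR ▸ T.inradius_pos
  refine ⟨hr, ?_⟩
  choose w hw using fun i => chart_surjective (C := C) hr (T.touchpoint ∅ i)
  choose z hz using fun i => chart_surjective (C := C) hr (T.points i)
  have hz' : T.points = fun i => chart C r (z i) := funext fun i => (hz i).symm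
  have hn : ∀ i, ‖w i‖ = 1 := by
    intro i
    have h := T.dist_incenter i
    rw [hC, hR, ← hw i] at h
    nth_rw 1 [← chart_zero C r] at h
    rw [dist_chart hr, zero_sub, norm_neg] at h
    exact (mul_eq_left₀ hr.ne').1 h
  have htan : ∀ i j, j ≠ i → (z j * conj (w i)).re = 1 := by
    intro i j hj
    have h1 : T.points j ∈ affineSpan ℝ (Set.range (T.faceOpposite i).points) := by
      apply mem_affineSpan
      rw [Affine.Simplex.range_faceOpposite_points]
      exact ⟨j, hj, rfl⟩
    have h2 := (T.isTangentAt_insphere_touchpoint i).le_orthRadius h1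
    rw [EuclideanGeometry.Sphere.mem_orthRadius_iff_inner_left, hT, vsub_eq_sub, vsub_eq_sub,
      ← hw, ← hz, chart_sub_chart] at h2
    simp only at h2
    nth_rw 2 [← chart_zero C r] at h2
    rw [chart_sub_chart, sub_zero, inner_smul_left, inner_smul_right, inner_planeIso, sub_mul,
      Complex.mul_conj, Complex.normSq_eq_norm_sq, hn] at h2
    simp [hr.ne'] at h2
    simp only [Complex.mul_re, Complex.conj_re, Complex.conj_im]
    linarith
  -- Positivity of the barycentric coordinates of the incenter, which separates it from the
  -- excenters, puts each vertex on the inner side of the opposite tangent.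
  have hlt : ∀ i, (z i * conj (w i)).re < 1 := by
    intro i
    have hl := T.excenterExists_empty.sum_excenterWeights_eq_one
    have h1 := T.incenter_eq_affineCombination
    rw [hz', affineCombination_chart _ hl, hC] at h1
    nth_rw 1 [← chart_zero C r] at h1
    have h2 := barycentric_mul_eq (htan i) hl (chart_injective hr h1).symm
    have h3 := T.excenterWeights_empty_pos i
    by_contra! h4
    nlinarith
  have hinj : ∀ i j, i ≠ j → w i ≠ w j := by
    intro i j hij h
    apply hij
    apply T.touchpoint_empty_injective
    rw [← hw, ← hw, h]
  have hv : ∀ i, w (i + 1) + w (i + 2) ≠ 0 ∧ z i = contactVertex w i := fun i =>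
    eq_tangentMeet (hn _) (hn _) (hinj _ _ (by decide +revert))
      (htan _ _ (by decide +revert)) (htan _ _ (by decide +revert))
  refine ⟨w, ⟨hn, ?_⟩, fun i => by rw [← hz, (hv i).2]⟩
  have h0 := hlt 0
  have h1 := hlt 1
  have h2 := hlt 2
  rw [(hv _).2] at h0 h1 h2
  refine norm_sum_lt_one_of_re_tangentMeet (hn _) (hn _) (hn _) (hv 2).1 ?_ (hv 0).1 h2 ?_ h0
  · rw [add_comm]; exact (hv 1).1
  · rw [tangentMeet_comm]; exact h1

/-- The function `1 - Re(z w̄ᵢ)` vanishes at the two vertices other than `i` and is positive at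
vertex `i`, so it recovers the `i`-th barycentric coordinate. -/
theorem IsContactTriple.affineIndependent {w : Fin 3 → ℂ} (h : IsContactTriple w) (C : Plane)
    {r : ℝ} (hr : 0 < r) : AffineIndependent ℝ (fun i => chart C r (contactVertex w i)) := by
  rw [affineIndependent_iff_eq_of_fintype_affineCombination_eq]
  intro l l' hl hl' he
  rw [affineCombination_chart _ hl, affineCombination_chart _ hl'] at he
  have he' := chart_injective hr he
  have key : ∀ l : Fin 3 → ℝ, ∑ j, l j = 1 → ∀ i, l i * (1 - (contactVertex w i * conj (w i)).re)
      = 1 - ((∑ j, (l j : ℂ) * contactVertex w j) * conj (w i)).re := by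
    intro l hl i
    have h1 : ((∑ j, (l j : ℂ) * contactVertex w j) * conj (w i)).re
        = ∑ j, l j * (contactVertex w j * conj (w i)).re := by
      rw [Finset.sum_mul, Complex.re_sum]
      refine Finset.sum_congr rfl fun j _ => ?_
      rw [mul_assoc, Complex.re_ofReal_mul]
    have h2 : ∑ j, l j * (1 - (contactVertex w j * conj (w i)).re)
        = 1 - ((∑ j, (l j : ℂ) * contactVertex w j) * conj (w i)).re := by
      simp only [mul_sub, mul_one, Finset.sum_sub_distrib, h1, hl]
    rw [← h2, Finset.sum_eq_single i]
    · intro j _ hj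
      rw [h.re_contactVertex_of_ne hj, sub_self, mul_zero]
    · simp
  funext i
  have h1 := key l hl i
  rw [he', ← key l' hl' i] at h1
  exact mul_right_cancel₀ (sub_pos.2 (h.re_contactVertex_lt i)).ne' h1

theorem IsContactTriple.isTangentAt {w : Fin 3 → ℂ} (h : IsContactTriple w) {C : Plane}
    {r : ℝ} (hr : 0 < r) {T : Affine.Triangle ℝ Plane}
    (hT : ∀ i, T.points i = chart C r (contactVertex w i)) (i : Fin 3) :
    (⟨C, r⟩ : EuclideanGeometry.Sphere Plane).IsTangentAt (chart C r (w i))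
      (affineSpan ℝ (Set.range (T.faceOpposite i).points)) := by
  have hd : dist (chart C r (w i)) C = r := by
    nth_rw 2 [← chart_zero C r]
    rw [dist_chart hr, sub_zero, h.norm_eq_one, mul_one]
  have hle : affineSpan ℝ (Set.range (T.faceOpposite i).points) ≤
      (⟨C, r⟩ : EuclideanGeometry.Sphere Plane).orthRadius (chart C r (w i)) := by
    rw [affineSpan_le, Affine.Simplex.range_faceOpposite_points]
    rintro _ ⟨j, hj, rfl⟩
    rw [SetLike.mem_coe, EuclideanGeometry.Sphere.mem_orthRadius_iff_inner_left, vsub_eq_sub,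
      vsub_eq_sub, hT, chart_sub_chart]
    simp only
    nth_rw 2 [← chart_zero C r]
    rw [chart_sub_chart, sub_zero, inner_smul_left, inner_smul_right, inner_planeIso, sub_mul,
      Complex.mul_conj, Complex.normSq_eq_norm_sq, h.norm_eq_one, Complex.sub_re,
      h.re_contactVertex_of_ne hj]
    simp
  have heq : affineSpan ℝ (Set.range (T.faceOpposite i).points) =
      (⟨C, r⟩ : EuclideanGeometry.Sphere Plane).orthRadius (chart C r (w i)) := by
    refine AffineSubspace.eq_of_direction_eq_of_nonempty_of_le ?_ ?_ hle
    · refine Submodule.eq_of_le_of_finrank_eq (AffineSubspace.direction_le hle) ?_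
      have h1 := EuclideanGeometry.Sphere.finrank_orthRadius
        (s := (⟨C, r⟩ : EuclideanGeometry.Sphere Plane)) (p := chart C r (w i))
        (by intro h0; simp only at h0; rw [h0, dist_self] at hd; exact hr.ne hd)
      have h2 := (T.faceOpposite i).independent.finrank_vectorSpan_add_one
      rw [direction_affineSpan]
      simp [Plane] at h1 h2 ⊢
      exact h2.trans h1.symm
    · exact Set.Nonempty.affineSpan ℝ (Set.range_nonempty _)
  refine ⟨?_, ?_, hle⟩
  · exact EuclideanGeometry.mem_sphere.2 hd
  · rw [heq]
    exact EuclideanGeometry.Sphere.self_mem_orthRadius _ _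

theorem IsContactTriple.insphere_eq {w : Fin 3 → ℂ} (h : IsContactTriple w) {C : Plane}
    {r : ℝ} (hr : 0 < r) {T : Affine.Triangle ℝ Plane}
    (hT : ∀ i, T.points i = chart C r (contactVertex w i)) : T.insphere = ⟨C, r⟩ := by
  have hmem : C ∈ affineSpan ℝ (Set.range T.points) := by
    rw [affineSpan_triangle]; trivial
  have hT' : T.points = fun i => chart C r (contactVertex w i) := funext hT
  have hdist : ∀ i, T.signedInfDist i C = r := by
    intro i
    have hp := (h.isTangentAt hr hT i).eq_orthogonalProjection
    have habs := Affine.Simplex.abs_signedInfDist_eq_dist_of_mem_affineSpan_range i hmem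
    have h1 : dist C ((T.faceOpposite i).orthogonalProjectionSpan C) = r := by
      have h2 : ((T.faceOpposite i).orthogonalProjectionSpan C : Plane) = chart C r (w i) :=
        hp.symm
      rw [h2]
      nth_rw 1 [← chart_zero C r]
      rw [dist_chart hr, zero_sub, norm_neg, h.norm_eq_one, mul_one]
    rw [h1] at habs
    -- The sign of the distance is that of a barycentric coordinate of `C`, positive because vertex
    -- `i` and `C` lie on the same side of the opposite tangent. Hence `C` is the incenter and not
    -- an excenter.
    have hnn : 0 ≤ T.signedInfDist i C := by
      obtain ⟨l, hl, hC⟩ := eq_affineCombination_of_mem_affineSpan_of_fintype hmem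
      have h3 := T.signedInfDist_affineCombination i hl
      rw [← hC] at h3
      rw [h3]
      refine mul_nonneg ?_ (norm_nonneg _)
      rw [hT', affineCombination_chart _ hl] at hC
      nth_rw 1 [← chart_zero C r] at hC
      have h4 := barycentric_mul_eq (i := i) (w := w i)
        (fun j hj => h.re_contactVertex_of_ne hj) hl (chart_injective hr hC).symm
      have h5 := h.re_contactVertex_lt i
      by_contra! h6
      nlinarith
    rwa [abs_of_nonneg hnn] at habs
  have hI : C = T.incenter :=
    (T.exists_forall_signedInfDist_eq_iff_eq_incenter hmem).1 ⟨r, hdist⟩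
  have hr' : T.inradius = r := by
    rw [← T.signedInfDist_incenter 0, ← hI, hdist]
  ext
  · rw [T.insphere_center, ← hI]
  · rw [T.insphere_radius, hr']

/-! ### The ellipse and the Poncelet condition -/

/-- The conic which passes through the points `-2 w`, `w ^ 3 = μ`. -/
def OnConic (k : ℝ) (μ z : ℂ) : Prop :=
  z * conj z - 4 = k * (z ^ 2 + conj z ^ 2 + 2 * conj μ * z + 2 * μ * conj z)

theorem onConic_tangentMeet_iff {k : ℝ} {μ a b : ℂ} (ha : ‖a‖ = 1) (hb : ‖b‖ = 1)
    (hab : a + b ≠ 0) : OnConic k μ (tangentMeet a b) ↔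
      a * b - (a + b) ^ 2 =
        k * ((a * b) ^ 2 + 1 + conj μ * (a * b) * (a + b) + μ * (a + b)) := by
  unfold OnConic
  rw [conj_tangentMeet ha hb]
  unfold tangentMeet
  constructor
  · intro h
    field_simp at h
    linear_combination h / 4
  · intro h
    field_simp
    linear_combination 4 * h

/-- Divided differences: `d1` and `d2` are first differences of the vertex equations divided by a
difference of contact points, `d3` is the second one, and eliminating between `d1` and `d3` leaves
the relation. -/
theorem sum_eq_of_onConic {k : ℝ} {μ a b c : ℂ} (hab : a ≠ b) (hac : a ≠ c) (hbc : b ≠ c)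
    (h1 : b * c - (b + c) ^ 2 =
      k * ((b * c) ^ 2 + 1 + conj μ * (b * c) * (b + c) + μ * (b + c)))
    (h2 : a * c - (a + c) ^ 2 =
      k * ((a * c) ^ 2 + 1 + conj μ * (a * c) * (a + c) + μ * (a + c)))
    (h3 : a * b - (a + b) ^ 2 =
      k * ((a * b) ^ 2 + 1 + conj μ * (a * b) * (a + b) + μ * (a + b))) :
    a + b + c = k * (a * b * c - μ) := by
  have d1 : -(a + b + c) = k * (c ^ 2 * (a + b) + conj μ * (a + b + c) * c + μ) :=
    mul_left_cancel₀ (sub_ne_zero.2 hab) (by linear_combination h2 - h1)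
  have d2 : -(a + b + c) = k * (a ^ 2 * (b + c) + conj μ * (a + b + c) * a + μ) :=
    mul_left_cancel₀ (sub_ne_zero.2 hbc) (by linear_combination h3 - h2)
  have d3 : k * (a * b + a * c + b * c + conj μ * (a + b + c)) = 0 :=
    mul_left_cancel₀ (sub_ne_zero.2 hac) (by linear_combination d1 - d2)
  linear_combination -d1 - c * d3

/-- On the unit circle conjugation yields a second relation among the contact points. Up to the
factor `c`, the vertex equation is a combination of the two relations. -/
theorem onConic_of_sum_eq {k : ℝ} {μ a b c : ℂ} (ha : ‖a‖ = 1) (hb : ‖b‖ = 1) (hc : ‖c‖ = 1)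
    (hμ : ‖μ‖ = 1) (hab : a + b ≠ 0) (h : a + b + c = k * (a * b * c - μ)) :
    OnConic k μ (tangentMeet a b) := by
  rw [onConic_tangentMeet_iff ha hb hab]
  have ha0 := ne_zero_of_norm_eq_one ha
  have hb0 := ne_zero_of_norm_eq_one hb
  have hc0 := ne_zero_of_norm_eq_one hc
  have hμ0 := ne_zero_of_norm_eq_one hμ
  have hμμ : μ * conj μ = 1 := by
    rw [conj_eq_inv_of_norm_eq_one hμ, mul_inv_cancel₀ hμ0]
  have h' : a * b + (a + b) * c = k * (1 - conj μ * (a * b * c)) := by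
    have := congrArg conj h
    simp only [map_add, map_mul, map_sub, Complex.conj_ofReal, conj_eq_inv_of_norm_eq_one ha,
      conj_eq_inv_of_norm_eq_one hb, conj_eq_inv_of_norm_eq_one hc] at this
    field_simp at this
    linear_combination this
  refine mul_left_cancel₀ hc0 ?_
  linear_combination (a * b + (a + b) * c - k - c * (a + b)) * h +
    (k * (a * b * c - μ) - k * c * (a * b) - (a + b)) * h' + k ^ 2 * c * (a * b) * hμμ

theorem norm_tangentMeet_sub_sq {a b c : ℂ} (ha : ‖a‖ = 1) (hb : ‖b‖ = 1) (hc : ‖c‖ = 1)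
    (hac : a + c ≠ 0) (hbc : b + c ≠ 0) :
    ‖tangentMeet a c - tangentMeet b c‖ ^ 2 *
      ((1 + (a * conj b).re) * (1 + (a * conj c).re) * (1 + (b * conj c).re)) =
      2 * (1 - (a * conj b).re ^ 2) := by
  have h1 : (tangentMeet a c - tangentMeet b c) * ((a + c) * (b + c)) = 2 * c ^ 2 * (a - b) := by
    unfold tangentMeet
    field_simp
    ring
  have h2 := congrArg (fun z => ‖z‖ ^ 2) h1
  have hs : ∀ x y : ℂ, ‖x‖ = 1 → ‖y‖ = 1 → ‖x + y‖ ^ 2 = 2 * (1 + (x * conj y).re) := by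
    intro x y hx hy
    rw [← Complex.normSq_eq_norm_sq, Complex.normSq_add, Complex.normSq_eq_norm_sq,
      Complex.normSq_eq_norm_sq, hx, hy]
    ring
  have hd : ‖a - b‖ ^ 2 = 2 * (1 - (a * conj b).re) := by
    rw [← Complex.normSq_eq_norm_sq, Complex.normSq_sub, Complex.normSq_eq_norm_sq,
      Complex.normSq_eq_norm_sq, ha, hb]
    ring
  have h3 : ‖(2 : ℂ)‖ = 2 := by simp
  simp only [norm_mul, norm_pow, hc, mul_pow, hs a c ha hc, hs b c hb hc, hd, h3] at h2
  linear_combination (1 + (a * conj b).re) / 4 * h2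

/-- Equal sides make the squares of the three cosines equal. With mixed signs the cosines would sum
to one of them, against acuteness; with equal signs the Gram relation leaves only `-1/2` for each,
so the squared norm of the sum is `0`. -/
theorem sum_eq_zero_of_norm_tangentMeet_sub_eq {a b c : ℂ} {l : ℝ} (ha : ‖a‖ = 1) (hb : ‖b‖ = 1)
    (hc : ‖c‖ = 1) (hab : a + b ≠ 0) (hac : a + c ≠ 0) (hbc : b + c ≠ 0) (h : ‖a + b + c‖ < 1)
    (h1 : ‖tangentMeet a c - tangentMeet b c‖ = l) (h2 : ‖tangentMeet a b - tangentMeet c b‖ = l)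
    (h3 : ‖tangentMeet b a - tangentMeet c a‖ = l) : a + b + c = 0 := by
  have e1 := norm_tangentMeet_sub_sq ha hb hc hac hbc
  have e2 := norm_tangentMeet_sub_sq ha hc hb hab (by rwa [add_comm])
  have e3 := norm_tangentMeet_sub_sq hb hc ha (by rwa [add_comm]) (by rwa [add_comm])
  rw [h1] at e1
  rw [h2] at e2
  rw [h3] at e3
  have hn := normSq_sum ha hb hc
  have hg := gram_eq_zero ha hb hc
  rw [norm_sum_lt_one_iff ha hb hc] at h
  rw [re_mul_conj_comm c b] at e2
  rw [re_mul_conj_comm b a, re_mul_conj_comm c a] at e3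
  have p1 := one_add_re_mul_conj_pos ha hb hab
  have p2 := one_add_re_mul_conj_pos ha hc hac
  have p3 := one_add_re_mul_conj_pos hb hc hbc
  set x := (a * conj b).re
  set y := (a * conj c).re
  set z := (b * conj c).re
  have hxy : y ^ 2 = x ^ 2 := by linear_combination (e2 - e1) / 2
  have hxz : z ^ 2 = x ^ 2 := by linear_combination (e3 - e1) / 2
  have hsum : x + y + z = -3 / 2 := by
    rcases sq_eq_sq_iff_eq_or_eq_neg.1 hxy with hy | hy <;>
      rcases sq_eq_sq_iff_eq_or_eq_neg.1 hxz with hz | hz <;> rw [hy, hz] at hg h ⊢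
    · have : (x - 1) ^ 2 * (2 * x + 1) = 0 := by linear_combination hg
      rcases mul_eq_zero.1 this with h0 | h0
      · nlinarith [pow_eq_zero_iff (two_ne_zero) |>.1 h0]
      · linarith
    · exfalso
      nlinarith
    · exfalso
      nlinarith
    · exfalso
      nlinarith
  rw [hsum] at hn
  have : ‖a + b + c‖ ^ 2 = 0 := by rw [hn]; norm_num
  exact norm_eq_zero.1 (pow_eq_zero_iff two_ne_zero |>.1 this)

theorem chart_mem_outerEllipse_iff {a b : ℝ} {C : Plane} {r : ℝ} (z : ℂ) :
    chart C r z ∈ outerEllipse a b ↔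
      ((r ^ 2 * (1 / a ^ 2 - 1 / b ^ 2) / 4 : ℝ) : ℂ) * (z ^ 2 + conj z ^ 2) +
      ((r ^ 2 * (1 / a ^ 2 + 1 / b ^ 2) / 2 : ℝ) : ℂ) * (z * conj z) +
      (⟨r * C 0 / a ^ 2, -(r * C 1 / b ^ 2)⟩ : ℂ) * z +
      conj (⟨r * C 0 / a ^ 2, -(r * C 1 / b ^ 2)⟩ : ℂ) * conj z +
      ((C 0 ^ 2 / a ^ 2 + C 1 ^ 2 / b ^ 2 - 1 : ℝ) : ℂ) = 0 := by
  have : ((r ^ 2 * (1 / a ^ 2 - 1 / b ^ 2) / 4 : ℝ) : ℂ) * (z ^ 2 + conj z ^ 2) +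
      ((r ^ 2 * (1 / a ^ 2 + 1 / b ^ 2) / 2 : ℝ) : ℂ) * (z * conj z) +
      (⟨r * C 0 / a ^ 2, -(r * C 1 / b ^ 2)⟩ : ℂ) * z +
      conj (⟨r * C 0 / a ^ 2, -(r * C 1 / b ^ 2)⟩ : ℂ) * conj z +
      ((C 0 ^ 2 / a ^ 2 + C 1 ^ 2 / b ^ 2 - 1 : ℝ) : ℂ) =
      ((((C 0 + r * z.re) / a) ^ 2 + ((C 1 + r * z.im) / b) ^ 2 - 1 : ℝ) : ℂ) := by
    apply Complex.ext
    · simp only [Complex.add_re, Complex.mul_re, Complex.ofReal_re, Complex.ofReal_im, pow_two,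
        Complex.conj_re, Complex.conj_im, Complex.add_im, Complex.mul_im]
      ring
    · simp only [Complex.add_re, Complex.mul_re, Complex.ofReal_re, Complex.ofReal_im, pow_two,
        Complex.conj_re, Complex.conj_im, Complex.add_im, Complex.mul_im]
      ring
  rw [this, Complex.ofReal_eq_zero, sub_eq_zero, outerEllipse, Set.mem_ofPred_eq,
    chart_apply_zero, chart_apply_one]

/-- The three points are the cube roots of `m = abc`, where `w² = m w̄`. So the conic equation at
`-2w` becomes real-linear, `A w + Ā w̄ + D = 0`; summing over the roots gives `D = 0`, and two of
the roots give `A = 0`. -/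
theorem coeff_eq_of_regular_triangle {α β δ : ℝ} {γ a b c : ℂ} (ha : ‖a‖ = 1) (hb : ‖b‖ = 1)
    (hc : ‖c‖ = 1) (hab : a + b ≠ 0) (hab' : a ≠ b) (h : a + b + c = 0)
    (h' : ∀ w ∈ ({a, b, c} : Set ℂ), (α : ℂ) * ((-2 * w) ^ 2 + conj (-2 * w) ^ 2) +
      β * ((-2 * w) * conj (-2 * w)) + γ * (-2 * w) + conj γ * conj (-2 * w) + δ = 0) :
    δ = -4 * β ∧ γ = 2 * α * conj (a * b * c) := by
  have ha0 := ne_zero_of_norm_eq_one ha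
  have hb0 := ne_zero_of_norm_eq_one hb
  have hc0 := ne_zero_of_norm_eq_one hc
  have h2 : a⁻¹ + b⁻¹ + c⁻¹ = 0 := by
    have := congrArg conj h
    simpa only [map_add, map_zero, conj_eq_inv_of_norm_eq_one ha, conj_eq_inv_of_norm_eq_one hb,
      conj_eq_inv_of_norm_eq_one hc] using this
  have e2 : a * b + a * c + b * c = 0 := by
    field_simp at h2
    linear_combination h2
  have key : ∀ w ∈ ({a, b, c} : Set ℂ), (4 * α * conj (a * b * c) - 2 * γ) * w
      + conj (4 * α * conj (a * b * c) - 2 * γ) * w⁻¹ + ((4 * β + δ : ℝ) : ℂ) = 0 := by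
    intro w hw
    have hw1 : ‖w‖ = 1 := by
      rcases hw with rfl | rfl | rfl <;> assumption
    have hw0 := ne_zero_of_norm_eq_one hw1
    have hw3 : w ^ 3 = a * b * c := by
      have : (w - a) * ((w - b) * (w - c)) = 0 := by
        rcases hw with rfl | rfl | rfl <;> ring
      linear_combination this + w ^ 2 * h - w * e2
    rw [← hw3, ← h' w hw]
    simp only [map_pow, map_mul, map_neg, map_sub, map_inv₀, inv_inv, Complex.conj_ofReal,
      Complex.conj_ofNat, conj_eq_inv_of_norm_eq_one hw1]
    push_cast
    field_simp
    ring
  have ka := key a (by simp)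
  have kb := key b (by simp)
  have kc := key c (by simp)
  set A := 4 * α * conj (a * b * c) - 2 * γ with hA
  have hD : ((4 * β + δ : ℝ) : ℂ) = 0 := by
    linear_combination (ka + kb + kc - A * h - conj A * h2) / 3
  rw [hD, add_zero] at ka kb
  have hA0 : A = 0 := by
    have ka' : A * a ^ 2 + conj A = 0 := by
      field_simp at ka
      linear_combination ka
    have kb' : A * b ^ 2 + conj A = 0 := by
      field_simp at kb
      linear_combination kb
    have : A * ((a + b) * (a - b)) = 0 := by linear_combination ka' - kb'
    rcases mul_eq_zero.1 this with h | h
    · exact h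
    · exact absurd h (mul_ne_zero hab (sub_ne_zero.2 hab'))
  constructor
  · have := Complex.ofReal_eq_zero.1 hD
    linarith
  · linear_combination (hA - hA0) / 2

theorem exists_onConic {a b : ℝ} (hb : 0 < b) (hab : b < a) {C : Plane} {r : ℝ}
    (hequi : ∃ T ∈ ponceletFamily a b C r, T.Equilateral) :
    0 < r ∧ ∃ (k : ℝ) (μ : ℂ), 0 < k ∧ 2 * k < 1 ∧ ‖μ‖ = 1 ∧
      ∀ z, chart C r z ∈ outerEllipse a b ↔ OnConic k μ z := by
  obtain ⟨T, ⟨hT, hins⟩, l, hl⟩ := hequi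
  obtain ⟨hr, w, hw, hTw⟩ := exists_contactTriple hins
  refine ⟨hr, ?_⟩
  have hn := hw.norm_eq_one
  have s0 := hw.add_ne_zero 0
  have s1 := hw.add_ne_zero 1
  have s2 := hw.add_ne_zero 2
  have v0 : contactVertex w 0 = tangentMeet (w 1) (w 2) := rfl
  have v1 : contactVertex w 1 = tangentMeet (w 2) (w 0) := rfl
  have v2 : contactVertex w 2 = tangentMeet (w 0) (w 1) := rfl
  change w 1 + w 2 ≠ 0 at s0
  change w 2 + w 0 ≠ 0 at s1
  change w 0 + w 1 ≠ 0 at s2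
  have hd : ∀ i j, i ≠ j → ‖contactVertex w i - contactVertex w j‖ = l / r := by
    intro i j hij
    have := hl i j hij
    rw [hTw, hTw, dist_chart hr] at this
    rw [eq_div_iff hr.ne', mul_comm, this]
  have hsum : w 0 + w 1 + w 2 = 0 := by
    refine sum_eq_zero_of_norm_tangentMeet_sub_eq (l := l / r) (hn 0) (hn 1) (hn 2) s2
      (by rwa [add_comm]) s0 hw.norm_sum_lt_one ?_ ?_ ?_
    · rw [tangentMeet_comm, ← v1, ← v0]
      exact hd 1 0 (by decide)
    · rw [tangentMeet_comm (w 2), ← v2, ← v0]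
      exact hd 2 0 (by decide)
    · rw [tangentMeet_comm, ← v2, ← v1]
      exact hd 2 1 (by decide)
  have hsum2 : w 0 * w 1 + w 0 * w 2 + w 1 * w 2 = 0 := by
    have := congrArg conj hsum
    have h0 := ne_zero_of_norm_eq_one (hn 0)
    have h1 := ne_zero_of_norm_eq_one (hn 1)
    have h2 := ne_zero_of_norm_eq_one (hn 2)
    simp only [map_add, map_zero, conj_eq_inv_of_norm_eq_one (hn _)] at this
    field_simp at this
    linear_combination this
  have hv0 : contactVertex w 0 = -2 * w 0 := by
    rw [v0, tangentMeet, div_eq_iff s0]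
    linear_combination 2 * hsum2
  have hv1 : contactVertex w 1 = -2 * w 1 := by
    rw [v1, tangentMeet, div_eq_iff s1]
    linear_combination 2 * hsum2
  have hv2 : contactVertex w 2 = -2 * w 2 := by
    rw [v2, tangentMeet, div_eq_iff s2]
    linear_combination 2 * hsum2
  have hon : ∀ i, chart C r (contactVertex w i) ∈ outerEllipse a b := fun i => hTw i ▸ hT i
  simp only [chart_mem_outerEllipse_iff] at hon
  obtain ⟨hδ, hγ⟩ := coeff_eq_of_regular_triangle (hn 0) (hn 1) (hn 2) s2
    (ne_of_norm_sum_lt_one (hn 0) (hn 2) hw.norm_sum_lt_one) hsum (by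
      rintro _ (rfl | rfl | rfl)
      · rw [← hv0]; exact hon 0
      · rw [← hv1]; exact hon 1
      · rw [← hv2]; exact hon 2)
  have ha : 0 < a := hb.trans hab
  have hba : 1 / a ^ 2 < 1 / b ^ 2 := by gcongr
  have ha2 : 0 < 1 / a ^ 2 := by positivity
  have hβ : 0 < r ^ 2 * (1 / a ^ 2 + 1 / b ^ 2) / 2 := by positivity
  -- `k` is minus the ratio of the coefficients of `z² + z̄²` and `z z̄`, so that `2k = (a² -
  -- b²)/(a² + b²)`.
  refine ⟨-(r ^ 2 * (1 / a ^ 2 - 1 / b ^ 2) / 4) / (r ^ 2 * (1 / a ^ 2 + 1 / b ^ 2) / 2),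
    w 0 * w 1 * w 2, ?_, ?_, ?_, ?_⟩
  · refine div_pos ?_ hβ
    have : 0 < r ^ 2 := by positivity
    nlinarith
  · rw [← mul_div_assoc, div_lt_one hβ]
    have : 0 < r ^ 2 := by positivity
    nlinarith
  · simp [hn]
  · intro z
    rw [chart_mem_outerEllipse_iff, hγ, hδ]
    generalize r ^ 2 * (1 / a ^ 2 - 1 / b ^ 2) / 4 = α
    have hβ' : ((r ^ 2 * (1 / a ^ 2 + 1 / b ^ 2) / 2 : ℝ) : ℂ) ≠ 0 := by exact_mod_cast hβ.ne'
    generalize r ^ 2 * (1 / a ^ 2 + 1 / b ^ 2) / 2 = β at hβ'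
    generalize w 0 * w 1 * w 2 = m
    unfold OnConic
    simp only [map_mul, Complex.conj_conj, Complex.conj_ofReal, Complex.conj_ofNat]
    push_cast
    constructor
    · intro h
      field_simp
      linear_combination h
    · intro h
      field_simp at h
      linear_combination h

/-- `w` is the triple of points of contact of a triangle which is inscribed in the conic
`OnConic k μ` and circumscribed about the unit circle. -/
structure IsPonceletTriple (k : ℝ) (μ : ℂ) (w : Fin 3 → ℂ) : Prop where
  norm_eq_one : ∀ i, ‖w i‖ = 1
  sum_eq : w 0 + w 1 + w 2 = k * (w 0 * w 1 * w 2 - μ)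

/-- Acuteness is automatic, since `|k(m - μ)| ≤ 2k < 1`. -/
theorem IsPonceletTriple.isContactTriple {k : ℝ} {μ : ℂ} {w : Fin 3 → ℂ}
    (h : IsPonceletTriple k μ w) (hk : 0 < k) (hk' : 2 * k < 1) (hμ : ‖μ‖ = 1) :
    IsContactTriple w := by
  refine ⟨h.norm_eq_one, ?_⟩
  rw [h.sum_eq, norm_mul, Complex.norm_real, Real.norm_eq_abs, abs_of_pos hk]
  have h1 : ‖w 0 * w 1 * w 2 - μ‖ ≤ 2 := by
    refine (norm_sub_le _ _).trans ?_
    simp only [norm_mul, h.norm_eq_one, hμ]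
    norm_num
  nlinarith

theorem mem_ponceletFamily_iff {a b : ℝ} {C : Plane} {r k : ℝ} {μ : ℂ} (hr : 0 < r) (hk : 0 < k)
    (hk' : 2 * k < 1) (hμ : ‖μ‖ = 1)
    (hE : ∀ z, chart C r z ∈ outerEllipse a b ↔ OnConic k μ z) (T : Affine.Triangle ℝ Plane) :
    T ∈ ponceletFamily a b C r ↔
      ∃ w, IsPonceletTriple k μ w ∧ ∀ i, T.points i = chart C r (contactVertex w i) := by
  constructor
  · rintro ⟨hT, hins⟩
    obtain ⟨_, w, hw, hTw⟩ := exists_contactTriple hins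
    refine ⟨w, ⟨hw.norm_eq_one, ?_⟩, hTw⟩
    have hon : ∀ i, OnConic k μ (contactVertex w i) := fun i => (hE _).1 (hTw i ▸ hT i)
    have hn := hw.norm_eq_one
    have h0 := (onConic_tangentMeet_iff (hn 1) (hn 2) (hw.add_ne_zero 0)).1 (hon 0)
    have h1 := (onConic_tangentMeet_iff (hn 2) (hn 0) (hw.add_ne_zero 1)).1 (hon 1)
    have h2 := (onConic_tangentMeet_iff (hn 0) (hn 1) (hw.add_ne_zero 2)).1 (hon 2)
    refine sum_eq_of_onConic (ne_of_norm_sum_lt_one (hn 0) (hn 2) (hw.norm_sum_lt 2))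
      (ne_of_norm_sum_lt_one (hn 2) (hn 1) (hw.norm_sum_lt 1)).symm
      (ne_of_norm_sum_lt_one (hn 1) (hn 0) (hw.norm_sum_lt 0)) h0 ?_ h2
    rw [mul_comm (w 0), add_comm (w 0)]
    exact h1
  · rintro ⟨w, hw, hTw⟩
    have hc := hw.isContactTriple hk hk' hμ
    refine ⟨fun i => ?_, hc.insphere_eq hr hTw⟩
    rw [hTw, hE]
    refine onConic_of_sum_eq (hw.norm_eq_one _) (hw.norm_eq_one _) (hw.norm_eq_one i) hμ
      (hc.add_ne_zero i) ?_
    have := hw.sum_eq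
    fin_cases i
    · simp; linear_combination this
    · simp; linear_combination this
    · exact this

/-! ### Poncelet triples through a given contact point -/

theorem mul_conj_of_norm_eq_one {z : ℂ} (hz : ‖z‖ = 1) : z * conj z = 1 := by
  rw [Complex.mul_conj, Complex.normSq_eq_norm_sq, hz]; simp

/-- `w` together with the two points of the unit circle which have sum `e` and product `q ^ 2`. -/
noncomputable def contactTriple (w q e : ℂ) : Fin 3 → ℂ :=
  ![w, q * (((e * conj q).re / 2 : ℝ) + Real.sqrt (1 - ((e * conj q).re / 2) ^ 2) * Complex.I),
    q * (((e * conj q).re / 2 : ℝ) - Real.sqrt (1 - ((e * conj q).re / 2) ^ 2) * Complex.I)]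

theorem half_re_mul_conj_sq_lt_one {q e : ℂ} (hq : ‖q‖ = 1) (he : ‖e‖ < 2) :
    ((e * conj q).re / 2) ^ 2 < 1 := by
  have h1 : |(e * conj q).re| ≤ ‖e‖ := by
    refine (Complex.abs_re_le_norm _).trans ?_
    rw [norm_mul, RCLike.norm_conj, hq, mul_one]
  rw [sq_lt_one_iff_abs_lt_one, abs_div, abs_two]
  linarith

/-- `hreal` says that `e q̄` is real, so the two further points are `q exp(±iφ)` with `2 cos φ = e
q̄`; `|e| < 2` makes `φ` real and the two points distinct. -/
theorem isPonceletTriple_contactTriple {k : ℝ} {μ w q e : ℂ} (hw : ‖w‖ = 1) (hq : ‖q‖ = 1)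
    (he : ‖e‖ < 2) (hreal : conj e * q ^ 2 = e) (hsum : w + e = k * (w * q ^ 2 - μ)) :
    IsPonceletTriple k μ (contactTriple w q e) := by
  have hlt := half_re_mul_conj_sq_lt_one hq he
  have hqq := mul_conj_of_norm_eq_one hq
  have hε : (((e * conj q).re : ℝ) : ℂ) = e * conj q := by
    rw [← Complex.conj_eq_iff_re, map_mul, Complex.conj_conj]
    linear_combination conj q * hreal - conj e * q * hqq
  have hs : Real.sqrt (1 - ((e * conj q).re / 2) ^ 2) ^ 2 = 1 - ((e * conj q).re / 2) ^ 2 :=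
    Real.sq_sqrt (by linarith)
  have hs' : ((Real.sqrt (1 - ((e * conj q).re / 2) ^ 2) : ℝ) : ℂ) ^ 2
      = 1 - (((e * conj q).re / 2 : ℝ) : ℂ) ^ 2 := by exact_mod_cast hs
  have hε2 : (((e * conj q).re / 2 : ℝ) : ℂ) = e * conj q / 2 := by push_cast; rw [hε]
  have hn : ∀ x s : ℝ, s ^ 2 = 1 - x ^ 2 → ‖((x : ℂ) + s * Complex.I)‖ = 1 := by
    intro x s h
    rw [Complex.norm_add_mul_I, h]
    norm_num
  refine ⟨?_, ?_⟩
  · intro i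
    fin_cases i
    · exact hw
    · simp only [contactTriple]
      change ‖q * _‖ = 1
      rw [norm_mul, hq, one_mul, hn _ _ hs]
    · simp only [contactTriple]
      change ‖q * _‖ = 1
      rw [norm_mul, hq, one_mul, sub_eq_add_neg, ← neg_mul, ← Complex.ofReal_neg,
        hn _ _ (by rw [neg_sq]; exact hs)]
  · change w + q * _ + q * _ = k * (w * (q * _) * (q * _) - μ)
    rw [hε2]
    rw [hε2] at hs'
    linear_combination hsum + e * hqq - k * w * q ^ 2 * hs' +
      k * w * q ^ 2 * (Real.sqrt (1 - ((e * conj q).re / 2) ^ 2) : ℂ) ^ 2 * Complex.I_sq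

/-- The denominator of the Blaschke product which maps a contact point to the product of the
contact points. -/
noncomputable def blaschkeDenom (k : ℝ) (μ w : ℂ) : ℂ := 1 + k * conj μ * w + k * w ^ 2

theorem blaschkeDenom_ne_zero {k : ℝ} {μ w : ℂ} (hk : 0 < k) (hk' : 2 * k < 1) (hμ : ‖μ‖ = 1)
    (hw : ‖w‖ = 1) : blaschkeDenom k μ w ≠ 0 := by
  intro h
  have h1 : (1 : ℂ) = -(k * conj μ * w + k * w ^ 2) := by
    unfold blaschkeDenom at h
    linear_combination h
  have h2 : ‖(1 : ℂ)‖ ≤ 2 * k := by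
    rw [h1, norm_neg]
    refine (norm_add_le _ _).trans ?_
    simp only [norm_mul, norm_pow, RCLike.norm_conj, hμ, hw, Complex.norm_real, Real.norm_eq_abs,
      abs_of_pos hk]
    linarith
  rw [norm_one] at h2
  linarith

/-- A square root of the product of the two contact points other than `w`. -/
noncomputable def contactPhase (k : ℝ) (μ w : ℂ) : ℂ :=
  w * conj (blaschkeDenom k μ w) / (‖blaschkeDenom k μ w‖ : ℂ)

theorem norm_contactPhase {k : ℝ} {μ w : ℂ} (hk : 0 < k) (hk' : 2 * k < 1) (hμ : ‖μ‖ = 1)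
    (hw : ‖w‖ = 1) : ‖contactPhase k μ w‖ = 1 := by
  have h := norm_ne_zero_iff.2 (blaschkeDenom_ne_zero hk hk' hμ hw)
  rw [contactPhase, norm_div, norm_mul, hw, RCLike.norm_conj, one_mul, Complex.norm_real,
    norm_norm, div_self h]

/-- Writing `h` for the denominator, the square of the phase is `w² h̄/h`. Dividing by `|h|` selects
a square root of it globally and smoothly on the circle. -/
theorem mul_contactPhase_sq {k : ℝ} {μ w : ℂ} (hk : 0 < k) (hk' : 2 * k < 1) (hμ : ‖μ‖ = 1)
    (hw : ‖w‖ = 1) :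
    w * contactPhase k μ w ^ 2 * blaschkeDenom k μ w = w ^ 3 + k * μ * w ^ 2 + k * w := by
  have h := blaschkeDenom_ne_zero hk hk' hμ hw
  have hn : (‖blaschkeDenom k μ w‖ : ℂ) ≠ 0 := by exact_mod_cast norm_ne_zero_iff.2 h
  have h1 := Complex.mul_conj' (blaschkeDenom k μ w)
  have h2 : w ^ 3 * conj (blaschkeDenom k μ w) = w ^ 3 + k * μ * w ^ 2 + k * w := by
    have hww := mul_conj_of_norm_eq_one hw
    simp only [blaschkeDenom, map_add, map_mul, map_pow, Complex.conj_conj, Complex.conj_ofReal,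
      map_one]
    linear_combination (k * μ * w ^ 2 + k * w * (w * conj w + 1)) * hww
  rw [← h2, contactPhase, div_pow, mul_pow]
  field_simp
  linear_combination w ^ 3 * conj (blaschkeDenom k μ w) * h1

/-- The Poncelet triple that contains `w`. -/
noncomputable def ponceletTriple (k : ℝ) (μ w : ℂ) : Fin 3 → ℂ :=
  contactTriple w (contactPhase k μ w) (k * (w * contactPhase k μ w ^ 2 - μ) - w)

theorem norm_ponceletTriple_sum_lt {k : ℝ} {μ w : ℂ} (hk : 0 < k) (hk' : 2 * k < 1) (hμ : ‖μ‖ = 1)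
    (hw : ‖w‖ = 1) : ‖k * (w * contactPhase k μ w ^ 2 - μ) - w‖ < 2 := by
  refine (norm_sub_le _ _).trans_lt ?_
  rw [norm_mul, Complex.norm_real, Real.norm_eq_abs, abs_of_pos hk, hw]
  have h1 : ‖w * contactPhase k μ w ^ 2 - μ‖ ≤ 2 := by
    refine (norm_sub_le _ _).trans ?_
    rw [norm_mul, norm_pow, norm_contactPhase hk hk' hμ hw, hw, hμ]
    norm_num
  nlinarith

theorem isPonceletTriple_ponceletTriple {k : ℝ} {μ w : ℂ} (hk : 0 < k) (hk' : 2 * k < 1)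
    (hμ : ‖μ‖ = 1) (hw : ‖w‖ = 1) : IsPonceletTriple k μ (ponceletTriple k μ w) := by
  refine isPonceletTriple_contactTriple hw (norm_contactPhase hk hk' hμ hw)
    (norm_ponceletTriple_sum_lt hk hk' hμ hw) ?_ (by ring)
  have h := mul_contactPhase_sq hk hk' hμ hw
  have hq := mul_conj_of_norm_eq_one (norm_contactPhase hk hk' hμ hw)
  have hww := mul_conj_of_norm_eq_one hw
  have hw0 := ne_zero_of_norm_eq_one hw
  have h3 : conj (contactPhase k μ w) ^ 2 * contactPhase k μ w ^ 2 = 1 := by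
    rw [← mul_pow, mul_comm, hq, one_pow]
  set q := contactPhase k μ w
  simp only [map_sub, map_mul, map_pow, Complex.conj_ofReal]
  refine mul_left_cancel₀ (pow_ne_zero 2 hw0) ?_
  unfold blaschkeDenom at h
  linear_combination -h + k * w ^ 2 * conj w * h3 + (k * w - w * q ^ 2) * hww

/-- Eliminating the other two contact points between the sum relation and its conjugate expresses
the product as a Blaschke quotient of `w 0`. -/
theorem IsPonceletTriple.prod_eq {k : ℝ} {μ : ℂ} {w : Fin 3 → ℂ} (h : IsPonceletTriple k μ w)
    (hk : 0 < k) (hk' : 2 * k < 1) (hμ : ‖μ‖ = 1) :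
    w 0 * w 1 * w 2 = w 0 * contactPhase k μ (w 0) ^ 2 := by
  have h1 := mul_contactPhase_sq hk hk' hμ (h.norm_eq_one 0)
  refine mul_right_cancel₀ (blaschkeDenom_ne_zero hk hk' hμ (h.norm_eq_one 0)) ?_
  rw [h1]
  have h2 := h.sum_eq
  have h3 := congrArg conj h2
  have n0 := ne_zero_of_norm_eq_one (h.norm_eq_one 0)
  have n1 := ne_zero_of_norm_eq_one (h.norm_eq_one 1)
  have n2 := ne_zero_of_norm_eq_one (h.norm_eq_one 2)
  simp only [map_add, map_mul, map_sub, Complex.conj_ofReal,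
    conj_eq_inv_of_norm_eq_one (h.norm_eq_one _)] at h3
  field_simp at h3
  unfold blaschkeDenom
  linear_combination w 0 * h3 - w 0 ^ 2 * h2

/-- The contact points with product `m` are roots of `w³ - k(m-μ)w² + k(1-mμ̄)w - m`. With `w = x²`,
`m = y²`, division by `x³y` turns this into `2i` times the imaginary part of `x³ȳ - k(m-μ)xȳ`. That
part changes sign under `x ↦ -x`, so it vanishes somewhere on the circle. -/
theorem exists_mul_contactPhase_sq_eq {k : ℝ} {μ m : ℂ} (hk : 0 < k) (hk' : 2 * k < 1)
    (hμ : ‖μ‖ = 1) (hm : ‖m‖ = 1) : ∃ w, ‖w‖ = 1 ∧ w * contactPhase k μ w ^ 2 = m := by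
  obtain ⟨y, hy⟩ := IsAlgClosed.exists_pow_nat_eq m (n := 2) (by norm_num)
  have hyn : ‖y‖ = 1 := by
    have := congrArg norm hy
    rw [norm_pow, hm] at this
    exact (pow_eq_one_iff_of_nonneg (norm_nonneg y) two_ne_zero).1 this
  set F : ℝ → ℝ := fun θ => (Complex.exp (θ * Complex.I) ^ 3 * conj y -
    k * (m - μ) * Complex.exp (θ * Complex.I) * conj y).im with hF
  have hcont : Continuous F := by
    rw [hF]
    exact Complex.continuous_im.comp (by fun_prop)
  have hodd : F Real.pi = -F 0 := by
    simp only [hF, Complex.exp_pi_mul_I, Complex.ofReal_zero, zero_mul, Complex.exp_zero,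
      ← Complex.neg_im]
    congr 1
    ring
  have h0 : (0 : ℝ) ∈ Set.range F := by
    rcases le_total (F 0) 0 with h | h
    · exact mem_range_of_exists_le_of_exists_ge hcont ⟨0, h⟩ ⟨Real.pi, by linarith⟩
    · exact mem_range_of_exists_le_of_exists_ge hcont ⟨Real.pi, by linarith⟩ ⟨0, h⟩
  obtain ⟨θ, hθ⟩ := h0
  have hx : ‖Complex.exp (θ * Complex.I)‖ = 1 := Complex.norm_exp_ofReal_mul_I θ
  simp only [hF] at hθ
  set x := Complex.exp (θ * Complex.I)
  have hw : ‖x ^ 2‖ = 1 := by rw [norm_pow, hx, one_pow]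
  refine ⟨x ^ 2, hw, ?_⟩
  refine mul_right_cancel₀ (blaschkeDenom_ne_zero hk hk' hμ hw) ?_
  rw [mul_contactPhase_sq hk hk' hμ hw]
  have h1 := Complex.conj_eq_iff_im.2 hθ
  have n0 := ne_zero_of_norm_eq_one hx
  have n1 := ne_zero_of_norm_eq_one hyn
  have n2 := ne_zero_of_norm_eq_one hm
  subst hy
  simp only [map_sub, map_mul, map_pow, map_inv₀, inv_inv, Complex.conj_ofReal,
    conj_eq_inv_of_norm_eq_one hx, conj_eq_inv_of_norm_eq_one hyn] at h1
  field_simp at h1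
  unfold blaschkeDenom
  linear_combination -h1

theorem contDiff_ponceletTriple {k : ℝ} {μ : ℂ} (hk : 0 < k) (hk' : 2 * k < 1) (hμ : ‖μ‖ = 1)
    (i : Fin 3) :
    ContDiff ℝ 1 (fun t : ℝ => ponceletTriple k μ (Complex.exp (t * Complex.I)) i) := by
  have hn : ∀ t : ℝ, ‖Complex.exp (t * Complex.I)‖ = 1 := Complex.norm_exp_ofReal_mul_I
  have hconj : ∀ {f : ℝ → ℂ}, ContDiff ℝ 1 f → ContDiff ℝ 1 (fun t => conj (f t)) := fun hf =>
    Complex.conjCLE.contDiff.comp hf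
  have hofReal : ∀ {f : ℝ → ℝ}, ContDiff ℝ 1 f → ContDiff ℝ 1 (fun t => (f t : ℂ)) := fun hf =>
    Complex.ofRealCLM.contDiff.comp hf
  have hre : ∀ {f : ℝ → ℂ}, ContDiff ℝ 1 f → ContDiff ℝ 1 (fun t => (f t).re) := fun hf =>
    Complex.reCLM.contDiff.comp hf
  have hw : ContDiff ℝ 1 (fun t : ℝ => Complex.exp (t * Complex.I)) :=
    ((hofReal contDiff_id).mul contDiff_const).cexp
  have hh : ContDiff ℝ 1 (fun t : ℝ => blaschkeDenom k μ (Complex.exp (t * Complex.I))) :=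
    (contDiff_const.add (contDiff_const.mul hw)).add (contDiff_const.mul (hw.pow 2))
  have hq : ContDiff ℝ 1 (fun t : ℝ => contactPhase k μ (Complex.exp (t * Complex.I))) := by
    simp only [contactPhase, div_eq_mul_inv]
    refine (hw.mul (hconj hh)).mul ((hofReal (hh.norm ℝ fun t => ?_)).inv fun t => ?_)
    · exact blaschkeDenom_ne_zero hk hk' hμ (hn t)
    · exact_mod_cast norm_ne_zero_iff.2 (blaschkeDenom_ne_zero hk hk' hμ (hn t))
  have he : ContDiff ℝ 1 (fun t : ℝ => (k : ℂ) * (Complex.exp (t * Complex.I) *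
      contactPhase k μ (Complex.exp (t * Complex.I)) ^ 2 - μ) - Complex.exp (t * Complex.I)) :=
    (contDiff_const.mul ((hw.mul (hq.pow 2)).sub contDiff_const)).sub hw
  have hε := (hre (he.mul (hconj hq))).div_const 2
  have hs := hofReal ((contDiff_const (c := (1 : ℝ))).sub (hε.pow 2) |>.sqrt fun t => by
    have := half_re_mul_conj_sq_lt_one (norm_contactPhase hk hk' hμ (hn t))
      (norm_ponceletTriple_sum_lt hk hk' hμ (hn t))
    linarith)
  fin_cases i
  · exact hw
  · exact hq.mul ((hofReal hε).add (hs.mul contDiff_const))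
  · exact hq.mul ((hofReal hε).sub (hs.mul contDiff_const))

/-! ### Circumcircle, radical axis and contact product -/

/-- Center and radius come from inversion in the unit circle: the vertices go to the midpoints of
the contact chords, hence the circumcircle to the nine-point circle of the contact triangle, with
center `σ/2` and radius `1/2`. -/
theorem norm_tangentMeet_add {a b c : ℂ} (ha : ‖a‖ = 1) (hb : ‖b‖ = 1) (hc : ‖c‖ = 1)
    (h : ‖a + b + c‖ < 1) :
    ‖tangentMeet a b + 2 * (a + b + c) / ((1 - ‖a + b + c‖ ^ 2 : ℝ) : ℂ)‖
      = 2 / (1 - ‖a + b + c‖ ^ 2) := by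
  have hab := add_ne_zero_of_norm_sum_lt_one hc h
  have hpos : 0 < 1 - ‖a + b + c‖ ^ 2 := by
    have := norm_nonneg (a + b + c)
    nlinarith
  have ha0 := ne_zero_of_norm_eq_one ha
  have hb0 := ne_zero_of_norm_eq_one hb
  have hc0 := ne_zero_of_norm_eq_one hc
  have hσ : conj (a + b + c) = a⁻¹ + b⁻¹ + c⁻¹ := by
    simp only [map_add, conj_eq_inv_of_norm_eq_one ha, conj_eq_inv_of_norm_eq_one hb,
      conj_eq_inv_of_norm_eq_one hc]
  have hS : ((1 - ‖a + b + c‖ ^ 2 : ℝ) : ℂ) = 1 - (a + b + c) * (a⁻¹ + b⁻¹ + c⁻¹) := by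
    rw [← hσ, Complex.mul_conj']
    push_cast
    rfl
  have hS0 : ((1 - ‖a + b + c‖ ^ 2 : ℝ) : ℂ) ≠ 0 := by exact_mod_cast hpos.ne'
  have key : (tangentMeet a b + 2 * (a + b + c) / ((1 - ‖a + b + c‖ ^ 2 : ℝ) : ℂ)) *
      conj (tangentMeet a b + 2 * (a + b + c) / ((1 - ‖a + b + c‖ ^ 2 : ℝ) : ℂ))
      = ((2 / (1 - ‖a + b + c‖ ^ 2) : ℝ) : ℂ) ^ 2 := by
    rw [map_add, conj_tangentMeet ha hb, map_div₀, Complex.conj_ofReal, map_mul, hσ,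
      Complex.conj_ofNat, tangentMeet, Complex.ofReal_div]
    generalize ((1 - ‖a + b + c‖ ^ 2 : ℝ) : ℂ) = S at hS hS0
    have e1 : a * b * S + (a + b + c) * (a + b) = -((a + b) * (a * b) / c) := by
      rw [hS]; field_simp; ring
    have e2 : S + (a⁻¹ + b⁻¹ + c⁻¹) * (a + b) = -((a + b) * c / (a * b)) := by
      rw [hS]; field_simp; ring
    have e3 : (a * b * S + (a + b + c) * (a + b)) * (S + (a⁻¹ + b⁻¹ + c⁻¹) * (a + b))
        = (a + b) ^ 2 := by
      rw [e1, e2]; field_simp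
    generalize a⁻¹ + b⁻¹ + c⁻¹ = σ' at e3
    push_cast
    field_simp
    linear_combination e3
  rw [Complex.mul_conj'] at key
  have key' : ‖tangentMeet a b + 2 * (a + b + c) / ((1 - ‖a + b + c‖ ^ 2 : ℝ) : ℂ)‖ ^ 2
      = (2 / (1 - ‖a + b + c‖ ^ 2)) ^ 2 := by exact_mod_cast key
  exact (sq_eq_sq₀ (norm_nonneg _) (by positivity)).1 key'

namespace IsContactTriple

variable {w : Fin 3 → ℂ} {C : Plane} {r : ℝ} {T : Affine.Triangle ℝ Plane}

theorem one_sub_norm_sum_sq_pos (h : IsContactTriple w) : 0 < 1 - ‖w 0 + w 1 + w 2‖ ^ 2 := by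
  have h1 := h.norm_sum_lt_one
  have := norm_nonneg (w 0 + w 1 + w 2)
  nlinarith

theorem circumcenter_and_circumradius (h : IsContactTriple w) (hr : 0 < r)
    (hT : ∀ i, T.points i = chart C r (contactVertex w i)) :
    T.circumcenter = chart C r
        (-(2 * (w 0 + w 1 + w 2) / ((1 - ‖w 0 + w 1 + w 2‖ ^ 2 : ℝ) : ℂ))) ∧
      T.circumradius = r * (2 / (1 - ‖w 0 + w 1 + w 2‖ ^ 2)) := by
  have hd : ∀ i, dist (T.points i) (chart C r
      (-(2 * (w 0 + w 1 + w 2) / ((1 - ‖w 0 + w 1 + w 2‖ ^ 2 : ℝ) : ℂ))))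
      = r * (2 / (1 - ‖w 0 + w 1 + w 2‖ ^ 2)) := by
    intro i
    have hp : w (i + 1) + w (i + 2) + w i = w 0 + w 1 + w 2 := by
      fin_cases i
      · simp; ring
      · simp; ring
      · rfl
    rw [hT, dist_chart hr, sub_neg_eq_add, ← hp, contactVertex,
      norm_tangentMeet_add (h.norm_eq_one _) (h.norm_eq_one _) (h.norm_eq_one _)
        (h.norm_sum_lt i)]
  have hmem : chart C r (-(2 * (w 0 + w 1 + w 2) / ((1 - ‖w 0 + w 1 + w 2‖ ^ 2 : ℝ) : ℂ))) ∈
      affineSpan ℝ (Set.range T.points) := by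
    rw [affineSpan_triangle]; trivial
  exact ⟨(T.eq_circumcenter_of_dist_eq hmem hd).symm, (T.eq_circumradius_of_dist_eq hmem hd).symm⟩

theorem radicalFn_chart (h : IsContactTriple w) (hr : 0 < r)
    (hT : ∀ i, T.points i = chart C r (contactVertex w i)) (z : ℂ) :
    radicalFn T (chart C r z) = r ^ 2 / (1 - ‖w 0 + w 1 + w 2‖ ^ 2) *
      (3 + ‖w 0 + w 1 + w 2‖ ^ 2 - 4 * (z * conj (w 0 + w 1 + w 2)).re) := by
  obtain ⟨h1, h2⟩ := h.circumcenter_and_circumradius hr hT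
  have hpos := h.one_sub_norm_sum_sq_pos
  rw [radicalFn, h.insphere_eq hr hT, EuclideanGeometry.Sphere.power,
    EuclideanGeometry.Sphere.power, T.circumsphere_center, T.circumsphere_radius, h1, h2,
    dist_chart hr]
  simp only
  nth_rw 2 [← chart_zero C r]
  rw [dist_chart hr, sub_zero]
  set σ := w 0 + w 1 + w 2
  have h3 : ‖z - -(2 * σ / ((1 - ‖σ‖ ^ 2 : ℝ) : ℂ))‖ ^ 2 = ‖z‖ ^ 2 +
      4 / (1 - ‖σ‖ ^ 2) * (z * conj σ).re + (2 / (1 - ‖σ‖ ^ 2)) ^ 2 * ‖σ‖ ^ 2 := by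
    have h4 : 2 * σ / ((1 - ‖σ‖ ^ 2 : ℝ) : ℂ) = ((2 / (1 - ‖σ‖ ^ 2) : ℝ) : ℂ) * σ := by
      push_cast; ring
    rw [sub_neg_eq_add, h4, ← Complex.normSq_eq_norm_sq, Complex.normSq_add, Complex.normSq_mul,
      Complex.normSq_ofReal, map_mul, Complex.conj_ofReal, mul_left_comm, Complex.re_ofReal_mul,
      Complex.normSq_eq_norm_sq, Complex.normSq_eq_norm_sq]
    ring
  rw [mul_pow, mul_pow, h3, mul_pow]
  field_simp
  ring

/-- Since `1 - |σ|²` is real and positive, the product of the contact points is minus the phase of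
the product of the vertices: symmetric and differentiable in the vertices. -/
theorem prod_contactVertex (h : IsContactTriple w) :
    contactVertex w 0 * contactVertex w 1 * contactVertex w 2 *
      ((1 - ‖w 0 + w 1 + w 2‖ ^ 2 : ℝ) : ℂ) = -8 * (w 0 * w 1 * w 2) := by
  have s0 : w 1 + w 2 ≠ 0 := h.add_ne_zero 0
  have s1 : w 2 + w 0 ≠ 0 := h.add_ne_zero 1
  have s2 : w 0 + w 1 ≠ 0 := h.add_ne_zero 2
  have n0 := ne_zero_of_norm_eq_one (h.norm_eq_one 0)
  have n1 := ne_zero_of_norm_eq_one (h.norm_eq_one 1)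
  have n2 := ne_zero_of_norm_eq_one (h.norm_eq_one 2)
  have v0 : contactVertex w 0 = tangentMeet (w 1) (w 2) := rfl
  have v1 : contactVertex w 1 = tangentMeet (w 2) (w 0) := rfl
  have v2 : contactVertex w 2 = tangentMeet (w 0) (w 1) := rfl
  have hS : ((1 - ‖w 0 + w 1 + w 2‖ ^ 2 : ℝ) : ℂ)
      = 1 - (w 0 + w 1 + w 2) * ((w 0)⁻¹ + (w 1)⁻¹ + (w 2)⁻¹) := by
    have : conj (w 0 + w 1 + w 2) = (w 0)⁻¹ + (w 1)⁻¹ + (w 2)⁻¹ := by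
      simp only [map_add, conj_eq_inv_of_norm_eq_one (h.norm_eq_one _)]
    rw [← this, Complex.mul_conj']
    push_cast
    rfl
  rw [hS, v0, v1, v2, tangentMeet, tangentMeet, tangentMeet]
  field_simp
  ring

theorem prod_contactVertex_ne_zero (h : IsContactTriple w) :
    contactVertex w 0 * contactVertex w 1 * contactVertex w 2 ≠ 0 := by
  intro h0
  have := h.prod_contactVertex
  rw [h0, zero_mul] at this
  have n0 := ne_zero_of_norm_eq_one (h.norm_eq_one 0)
  have n1 := ne_zero_of_norm_eq_one (h.norm_eq_one 1)
  have n2 := ne_zero_of_norm_eq_one (h.norm_eq_one 2)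
  simp [n0, n1, n2] at this

theorem prod_eq (h : IsContactTriple w) : w 0 * w 1 * w 2 =
    -(contactVertex w 0 * contactVertex w 1 * contactVertex w 2 /
      (‖contactVertex w 0 * contactVertex w 1 * contactVertex w 2‖ : ℂ)) := by
  have h1 := h.prod_contactVertex
  have hpos := h.one_sub_norm_sum_sq_pos
  have h2 := congrArg norm h1
  have h8 : ‖(-8 : ℂ)‖ = 8 := by simp
  rw [norm_mul, norm_mul (-8 : ℂ), norm_mul (w 0 * w 1), norm_mul (w 0), h.norm_eq_one,
    h.norm_eq_one, h.norm_eq_one, Complex.norm_real, Real.norm_eq_abs, abs_of_pos hpos, h8] at h2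
  have h0 : (‖contactVertex w 0 * contactVertex w 1 * contactVertex w 2‖ : ℂ) ≠ 0 := by
    exact_mod_cast norm_ne_zero_iff.2 h.prod_contactVertex_ne_zero
  have h3 : (‖contactVertex w 0 * contactVertex w 1 * contactVertex w 2‖ : ℂ) *
      ((1 - ‖w 0 + w 1 + w 2‖ ^ 2 : ℝ) : ℂ) = 8 := by
    have : ‖contactVertex w 0 * contactVertex w 1 * contactVertex w 2‖ *
      (1 - ‖w 0 + w 1 + w 2‖ ^ 2) = 8 := by linarith
    exact_mod_cast this
  have h4 : ((1 - ‖w 0 + w 1 + w 2‖ ^ 2 : ℝ) : ℂ) ≠ 0 := by exact_mod_cast hpos.ne'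
  rw [eq_neg_iff_add_eq_zero, ← mul_right_inj' h0, mul_add, mul_div_cancel₀ _ h0,
    ← mul_left_inj' h4]
  linear_combination w 0 * w 1 * w 2 * h3 + h1

/-- The quotient of a tangent meet by its conjugate is the product of its two contact points. Thus
differentiability passes from the vertices to the contact points. -/
theorem eq_prod_mul_div (h : IsContactTriple w) (i : Fin 3) :
    w i = w 0 * w 1 * w 2 * conj (contactVertex w i) / contactVertex w i := by
  have n1 := ne_zero_of_norm_eq_one (h.norm_eq_one (i + 1))
  have n2 := ne_zero_of_norm_eq_one (h.norm_eq_one (i + 2))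
  have s := h.add_ne_zero i
  have hp : w 0 * w 1 * w 2 = w (i + 1) * w (i + 2) * w i := by
    fin_cases i
    · simp; ring
    · simp; ring
    · rfl
  rw [contactVertex, conj_tangentMeet (h.norm_eq_one _) (h.norm_eq_one _), tangentMeet, hp]
  field_simp

end IsContactTriple

/-- The numerator of the difference of the powers of the point with coordinate `z` with respect to
the incircle and to the circumcircle, in terms of the product `m` of the contact points. -/
noncomputable def radicalNumer (k : ℝ) (μ z m : ℂ) : ℝ :=
  3 + 4 * k * ((z + k * μ / 2) * conj μ).re - 4 * k * (conj m * (z + k * μ / 2)).re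

namespace IsPonceletTriple

variable {w : Fin 3 → ℂ} {C : Plane} {r k : ℝ} {μ : ℂ} {T : Affine.Triangle ℝ Plane}

theorem norm_prod (h : IsPonceletTriple k μ w) : ‖w 0 * w 1 * w 2‖ = 1 := by
  simp [h.norm_eq_one]

/-- On the family `|σ|² = 2k² - 2k² Re(m μ̄)` is affine in `m`; absorbing it shifts `z` by `kμ/2`.
-/
theorem radicalFn_chart (h : IsPonceletTriple k μ w) (hk : 0 < k) (hk' : 2 * k < 1) (hμ : ‖μ‖ = 1)
    (hr : 0 < r) (hT : ∀ i, T.points i = chart C r (contactVertex w i)) (z : ℂ) :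
    radicalFn T (chart C r z) =
      r ^ 2 / (1 - ‖k * (w 0 * w 1 * w 2 - μ)‖ ^ 2) * radicalNumer k μ z (w 0 * w 1 * w 2) := by
  rw [(h.isContactTriple hk hk' hμ).radicalFn_chart hr hT, h.sum_eq]
  congr 1
  have h1 := re_sq_add_im_sq hμ
  have h2 := re_sq_add_im_sq h.norm_prod
  generalize w 0 * w 1 * w 2 = m at h2
  have h3 : (k * μ / 2 : ℂ) = ((k / 2 : ℝ) : ℂ) * μ := by push_cast; ring
  rw [radicalNumer, ← Complex.normSq_eq_norm_sq, Complex.normSq_apply, h3]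
  simp only [Complex.mul_re, Complex.mul_im, Complex.add_re, Complex.add_im, Complex.sub_re,
    Complex.sub_im, Complex.conj_re, Complex.conj_im, Complex.ofReal_re, Complex.ofReal_im]
  linear_combination k ^ 2 * h2 - k ^ 2 * h1

end IsPonceletTriple

/-! ### Arbitrary regular parametrizations -/

/-- Differentiating the monic cubic at a simple root: if its coefficients are stationary, so is the
root. -/
theorem deriv_eq_zero_of_symmetric {f g h : ℝ → ℂ} {x y z : ℂ} {u : ℝ} (hf : HasDerivAt f x u)
    (hg : HasDerivAt g y u) (hh : HasDerivAt h z u)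
    (h1 : HasDerivAt (fun t => f t + g t + h t) 0 u)
    (h2 : HasDerivAt (fun t => f t * g t + f t * h t + g t * h t) 0 u)
    (h3 : HasDerivAt (fun t => f t * g t * h t) 0 u)
    (hfg : f u ≠ g u) (hfh : f u ≠ h u) (hgh : g u ≠ h u) : x = 0 ∧ y = 0 ∧ z = 0 := by
  have e1 := ((hf.fun_add hg).fun_add hh).unique h1
  have e2 := (((hf.fun_mul hg).fun_add (hf.fun_mul hh)).fun_add (hg.fun_mul hh)).unique h2
  have e3 := ((hf.fun_mul hg).fun_mul hh).unique h3
  have k1 : x * ((f u - g u) * (f u - h u)) = 0 := by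
    linear_combination f u ^ 2 * e1 - f u * e2 + e3
  have k2 : y * ((g u - f u) * (g u - h u)) = 0 := by
    linear_combination g u ^ 2 * e1 - g u * e2 + e3
  have k3 : z * ((h u - f u) * (h u - g u)) = 0 := by
    linear_combination h u ^ 2 * e1 - h u * e2 + e3
  refine ⟨?_, ?_, ?_⟩
  · exact (mul_eq_zero.1 k1).resolve_right (mul_ne_zero (sub_ne_zero.2 hfg) (sub_ne_zero.2 hfh))
  · exact (mul_eq_zero.1 k2).resolve_right
      (mul_ne_zero (sub_ne_zero.2 hfg.symm) (sub_ne_zero.2 hgh))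
  · exact (mul_eq_zero.1 k3).resolve_right
      (mul_ne_zero (sub_ne_zero.2 hfh.symm) (sub_ne_zero.2 hgh.symm))

theorem hasDerivAt_chart {f : ℝ → ℂ} {x : ℂ} {u : ℝ} (hf : HasDerivAt f x u) (C : Plane) (r : ℝ) :
    HasDerivAt (fun t => chart C r (f t)) (r • planeIso x) u := by
  have h1 : HasDerivAt (fun t => planeIso (f t)) (planeIso x) u :=
    planeIso.toContinuousLinearEquiv.toContinuousLinearMap.hasFDerivAt.comp_hasDerivAt u hf
  exact (h1.const_smul r).const_add C

theorem hasDerivAt_of_hasDerivAt_chart {f : ℝ → ℂ} {x : Plane} {u : ℝ} {C : Plane} {r : ℝ}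
    (hr : r ≠ 0) (hf : HasDerivAt (fun t => chart C r (f t)) x u) :
    HasDerivAt f (r⁻¹ • planeIso.symm x) u := by
  have h1 : HasDerivAt (fun t => planeIso.symm (chart C r (f t))) (planeIso.symm x) u :=
    planeIso.symm.toContinuousLinearEquiv.toContinuousLinearMap.hasFDerivAt.comp_hasDerivAt u hf
  have h2 := (h1.sub_const (planeIso.symm C)).const_smul r⁻¹
  have h3 : f = fun t => r⁻¹ • (planeIso.symm (chart C r (f t)) - planeIso.symm C) := by
    funext t
    rw [chart, map_add, map_smul, LinearIsometryEquiv.symm_apply_apply, add_sub_cancel_left,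
      smul_smul, inv_mul_cancel₀ hr, one_smul]
  rw [h3]
  exact h2

theorem exists_perm_of_range_eq {X : Type*} {f g : Fin 3 → X} (hf : Function.Injective f)
    (hg : Function.Injective g) (h : Set.range f = Set.range g) :
    ∃ e : Equiv.Perm (Fin 3), ∀ i, f i = g (e i) := by
  refine ⟨(Equiv.ofInjective f hf).trans ((Equiv.setCongr h).trans (Equiv.ofInjective g hg).symm),
    fun i => ?_⟩
  have := Equiv.apply_ofInjective_symm hg
    ((Equiv.setCongr h) (Equiv.ofInjective f hf i))
  simp only [Equiv.trans_apply]
  rw [this]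
  rfl

theorem IsContactTriple.prod_eq_of_range_eq {w w' : Fin 3 → ℂ} (h : IsContactTriple w)
    (h' : IsContactTriple w') {C : Plane} {r : ℝ} (hr : 0 < r) {T T' : Affine.Triangle ℝ Plane}
    (hT : ∀ i, T.points i = chart C r (contactVertex w i))
    (hT' : ∀ i, T'.points i = chart C r (contactVertex w' i))
    (hrange : Set.range T.points = Set.range T'.points) :
    w 0 * w 1 * w 2 = w' 0 * w' 1 * w' 2 := by
  obtain ⟨e, he⟩ := exists_perm_of_range_eq T.independent.injective T'.independent.injective hrange
  have h1 : ∀ i, contactVertex w i = contactVertex w' (e i) := by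
    intro i
    apply chart_injective (C := C) hr
    rw [← hT, ← hT', he]
  have h2 : ∏ i, contactVertex w i = ∏ i, contactVertex w' i := by
    simp_rw [h1]
    exact Equiv.prod_comp e _
  rw [Fin.prod_univ_three, Fin.prod_univ_three] at h2
  rw [h.prod_eq, h'.prod_eq, h2]

/-- Reduces every parametrization to a curve `m` onto the unit circle with nonvanishing velocity,
which is all that the envelope depends on. -/
theorem exists_contactProd {a b : ℝ} {C : Plane} {r k : ℝ} {μ : ℂ} (hr : 0 < r) (hk : 0 < k)
    (hk' : 2 * k < 1) (hμ : ‖μ‖ = 1)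
    (hE : ∀ z, chart C r z ∈ outerEllipse a b ↔ OnConic k μ z) {T : ℝ → Affine.Triangle ℝ Plane}
    (hT : IsRegularParam (ponceletFamily a b C r) T) :
    ∃ m m' : ℝ → ℂ, (∀ u, ‖m u‖ = 1) ∧ (∀ u, HasDerivAt m (m' u) u) ∧ (∀ u, m' u ≠ 0) ∧
      (∀ u z, radicalFn (T u) (chart C r z) =
        r ^ 2 / (1 - ‖k * (m u - μ)‖ ^ 2) * radicalNumer k μ z (m u)) ∧
      ∀ m₀ : ℂ, ‖m₀‖ = 1 → ∃ u, m u = m₀ := by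
  choose w hw hTw using fun u => (mem_ponceletFamily_iff hr hk hk' hμ hE (T u)).1 (hT.mem u)
  have hc := fun u => (hw u).isContactTriple hk hk' hμ
  have hV : ∀ i u, DifferentiableAt ℝ (fun t => contactVertex (w t) i) u := by
    intro i u
    have h1 := ((hT.contDiff i).differentiable one_ne_zero u).hasDerivAt
    simp_rw [hTw] at h1
    exact (hasDerivAt_of_hasDerivAt_chart hr.ne' h1).differentiableAt
  have hm : ∀ u, DifferentiableAt ℝ (fun t => w t 0 * w t 1 * w t 2) u := by
    intro u
    have h1 : (fun t => w t 0 * w t 1 * w t 2) = fun t =>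
        -(contactVertex (w t) 0 * contactVertex (w t) 1 * contactVertex (w t) 2 /
        (‖contactVertex (w t) 0 * contactVertex (w t) 1 * contactVertex (w t) 2‖ : ℂ)) :=
      funext fun t => (hc t).prod_eq
    rw [h1]
    have h2 := ((hV 0 u).fun_mul (hV 1 u)).fun_mul (hV 2 u)
    have h3 := (hc u).prod_contactVertex_ne_zero
    have h4 : DifferentiableAt ℝ (fun t => ((‖contactVertex (w t) 0 * contactVertex (w t) 1 *
        contactVertex (w t) 2‖ : ℝ) : ℂ)) u :=
      Complex.ofRealCLM.differentiableAt.comp u (h2.norm ℝ h3)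
    have h5 : ((‖contactVertex (w u) 0 * contactVertex (w u) 1 *
        contactVertex (w u) 2‖ : ℝ) : ℂ) ≠ 0 := by exact_mod_cast norm_ne_zero_iff.2 h3
    simp only [div_eq_mul_inv]
    exact (h2.fun_mul (h4.fun_inv h5)).fun_neg
  have hV0 : ∀ i u, contactVertex (w u) i ≠ 0 := by
    intro i u h0
    apply (hc u).prod_contactVertex_ne_zero
    fin_cases i <;> simp at h0 <;> simp [h0]
  have hwd : ∀ i u, DifferentiableAt ℝ (fun t => w t i) u := by
    intro i u
    have h1 : (fun t => w t i) = fun t =>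
        w t 0 * w t 1 * w t 2 * conj (contactVertex (w t) i) * (contactVertex (w t) i)⁻¹ :=
      funext fun t => (hc t).eq_prod_mul_div i
    rw [h1]
    have h2 : DifferentiableAt ℝ (fun t => conj (contactVertex (w t) i)) u :=
      Complex.conjCLE.differentiableAt.comp u (hV i u)
    exact ((hm u).fun_mul h2).fun_mul ((hV i u).fun_inv (hV0 i u))
  refine ⟨fun u => w u 0 * w u 1 * w u 2, deriv fun u => w u 0 * w u 1 * w u 2,
    fun u => (hw u).norm_prod, fun u => (hm u).hasDerivAt, ?_,
    fun u z => (hw u).radicalFn_chart hk hk' hμ hr (hTw u) z, ?_⟩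
  -- If `m' = 0`, all elementary symmetric functions of the contact points are stationary, hence so
  -- are the contact points and then the vertices, against regularity.
  · intro u h0
    have hm0 : HasDerivAt (fun t => w t 0 * w t 1 * w t 2) 0 u := h0 ▸ (hm u).hasDerivAt
    have hs1 : HasDerivAt (fun t => w t 0 + w t 1 + w t 2) 0 u := by
      simp_rw [(hw _).sum_eq]
      simpa using (hm0.sub_const μ).const_mul (k : ℂ)
    have hs2 : HasDerivAt (fun t => w t 0 * w t 1 + w t 0 * w t 2 + w t 1 * w t 2) 0 u := by
      have h1 : (fun t => w t 0 * w t 1 + w t 0 * w t 2 + w t 1 * w t 2) =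
          fun t => (k : ℂ) * (1 - conj μ * (w t 0 * w t 1 * w t 2)) := by
        funext t
        have h2 := congrArg conj (hw t).sum_eq
        have n0 := ne_zero_of_norm_eq_one ((hw t).norm_eq_one 0)
        have n1 := ne_zero_of_norm_eq_one ((hw t).norm_eq_one 1)
        have n2 := ne_zero_of_norm_eq_one ((hw t).norm_eq_one 2)
        simp only [map_add, map_mul, map_sub, Complex.conj_ofReal,
          conj_eq_inv_of_norm_eq_one ((hw t).norm_eq_one _)] at h2
        field_simp at h2
        linear_combination h2
      rw [h1]
      simpa using ((hm0.const_mul (conj μ)).const_sub 1).const_mul (k : ℂ)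
    obtain ⟨x0, x1, x2⟩ := deriv_eq_zero_of_symmetric (hwd 0 u).hasDerivAt (hwd 1 u).hasDerivAt
      (hwd 2 u).hasDerivAt hs1 hs2 hm0
      (ne_of_norm_sum_lt_one ((hw u).norm_eq_one 0) ((hw u).norm_eq_one 2) ((hc u).norm_sum_lt 2))
      (ne_of_norm_sum_lt_one ((hw u).norm_eq_one 2) ((hw u).norm_eq_one 1)
        ((hc u).norm_sum_lt 1)).symm
      (ne_of_norm_sum_lt_one ((hw u).norm_eq_one 1) ((hw u).norm_eq_one 0) ((hc u).norm_sum_lt 0))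
    have hx : ∀ i, HasDerivAt (fun t => w t i) 0 u := by
      intro i
      have h1 := (hwd i u).hasDerivAt
      fin_cases i
      · exact x0 ▸ h1
      · exact x1 ▸ h1
      · exact x2 ▸ h1
    obtain ⟨i, hi⟩ := hT.regular u
    apply hi
    have h1 : HasDerivAt (fun t => contactVertex (w t) i) 0 u := by
      have h2 := (((hx (i + 1)).const_mul 2).fun_mul (hx (i + 2))).fun_div
        ((hx (i + 1)).fun_add (hx (i + 2))) ((hc u).add_ne_zero i)
      simpa [contactVertex, tangentMeet] using h2
    have h2 := hasDerivAt_chart h1 C r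
    simp_rw [← hTw] at h2
    rw [h2.deriv, map_zero, smul_zero]
  · intro m₀ hm₀
    obtain ⟨v, hv, hvm⟩ := exists_mul_contactPhase_sq_eq hk hk' hμ hm₀
    have hp := isPonceletTriple_ponceletTriple hk hk' hμ hv
    have hpc := hp.isContactTriple hk hk' hμ
    let S : Affine.Triangle ℝ Plane := ⟨_, hpc.affineIndependent C hr⟩
    have hS : ∀ i, S.points i = chart C r (contactVertex (ponceletTriple k μ v) i) := fun _ => rfl
    obtain ⟨u, hu⟩ := hT.covers S ((mem_ponceletFamily_iff hr hk hk' hμ hE S).2 ⟨_, hp, hS⟩)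
    refine ⟨u, ?_⟩
    simp only
    rw [(hc u).prod_eq_of_range_eq hpc hr (hTw u) hS hu, hp.prod_eq hk hk' hμ]
    exact hvm

/-! ### The envelope -/

theorem exists_radicalNumer_eq_zero_iff {k : ℝ} {μ z : ℂ} (hk : 0 < k) :
    (∃ m, ‖m‖ = 1 ∧ radicalNumer k μ z m = 0 ∧ (conj m * (z + k * μ / 2)).im = 0) ↔
      ‖z + k * μ / 2‖ = |((z + k * μ / 2) * conj μ).re + 3 / (4 * k)| := by
  unfold radicalNumer
  generalize z + k * μ / 2 = Y
  constructor
  · rintro ⟨m, hm, h1, h2⟩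
    have h3 : (Y * conj μ).re + 3 / (4 * k) = (conj m * Y).re := by
      rw [mul_comm (conj m)] at h1 ⊢
      field_simp
      linarith
    rw [h3, Complex.abs_re_eq_norm.2 h2, norm_mul, RCLike.norm_conj, hm, one_mul]
  · intro h
    set A := (Y * conj μ).re + 3 / (4 * k) with hA
    have hA0 : A ≠ 0 := by
      intro h0
      rw [h0, abs_zero, norm_eq_zero] at h
      rw [h, zero_mul, Complex.zero_re, zero_add] at hA
      rw [h0] at hA
      have : 0 < 3 / (4 * k) := by positivity
      linarith
    have hAc : (A : ℂ) ≠ 0 := by exact_mod_cast hA0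
    have h1 : conj (Y / A) * Y = A := by
      rw [map_div₀, Complex.conj_ofReal, div_mul_eq_mul_div, Complex.conj_mul', h,
        ← Complex.ofReal_pow, sq_abs, Complex.ofReal_pow]
      field_simp
    -- The two conditions say that `m̄ Y` is the real number `A`; with `|m| = 1` this forces `m = Y
    -- / A`.
    refine ⟨Y / A, ?_, ?_, ?_⟩
    · rw [norm_div, h, Complex.norm_real, Real.norm_eq_abs, div_self (abs_ne_zero.2 hA0)]
    · rw [h1, Complex.ofReal_re, hA]
      field_simp
      ring
    · rw [h1, Complex.ofReal_im]

theorem hasDerivAt_radicalNumer {m : ℝ → ℂ} {m' : ℂ} {u : ℝ} (hm : HasDerivAt m m' u) (k : ℝ)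
    (μ z : ℂ) : HasDerivAt (fun t => radicalNumer k μ z (m t))
      (-(4 * k * (conj m' * (z + k * μ / 2)).re)) u := by
  have h1 : HasDerivAt (fun t => conj (m t)) (conj m') u :=
    Complex.conjCLE.toContinuousLinearMap.hasFDerivAt.comp_hasDerivAt u hm
  have h2 : HasDerivAt (fun t => (conj (m t) * (z + k * μ / 2)).re)
      (conj m' * (z + k * μ / 2)).re u :=
    Complex.reCLM.hasFDerivAt.comp_hasDerivAt u (h1.mul_const _)
  exact (h2.const_mul (4 * k)).const_sub _

theorem mem_envelope_iff {a b : ℝ} {C : Plane} {r k : ℝ} {μ : ℂ} (hr : 0 < r) (hk : 0 < k)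
    (hk' : 2 * k < 1) (hμ : ‖μ‖ = 1)
    (hE : ∀ z, chart C r z ∈ outerEllipse a b ↔ OnConic k μ z) {T : ℝ → Affine.Triangle ℝ Plane}
    (hT : IsRegularParam (ponceletFamily a b C r) T) (z : ℂ) :
    chart C r z ∈ envelope (fun u => radicalFn (T u)) ↔
      ‖z + k * μ / 2‖ = |((z + k * μ / 2) * conj μ).re + 3 / (4 * k)| := by
  obtain ⟨m, m', hm, hmd, hm0, hG, hsurj⟩ := exists_contactProd hr hk hk' hμ hE hT
  rw [← exists_radicalNumer_eq_zero_iff hk]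
  have hpos : ∀ u, 0 < 1 - ‖k * (m u - μ)‖ ^ 2 := by
    intro u
    have h1 : ‖k * (m u - μ)‖ < 1 := by
      rw [norm_mul, Complex.norm_real, Real.norm_eq_abs, abs_of_pos hk]
      have : ‖m u - μ‖ ≤ 2 := by
        refine (norm_sub_le _ _).trans ?_
        rw [hm, hμ]; norm_num
      nlinarith
    have := norm_nonneg (k * (m u - μ))
    nlinarith
  -- At a zero of the numerator the derivative of the positive factor drops out.
  have hderiv : ∀ u, radicalNumer k μ z (m u) = 0 →
      (HasDerivAt (fun v => radicalFn (T v) (chart C r z)) 0 u ↔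
        (conj (m u) * (z + k * μ / 2)).im = 0) := by
    intro u hu
    have hc : DifferentiableAt ℝ (fun t => r ^ 2 / (1 - ‖k * (m t - μ)‖ ^ 2)) u := by
      have h1 : DifferentiableAt ℝ (fun t => (k : ℂ) * (m t - μ)) u :=
        ((hmd u).differentiableAt.sub_const μ).const_mul (k : ℂ)
      have h2 : DifferentiableAt ℝ (fun t => 1 - ‖k * (m t - μ)‖ ^ 2) u :=
        (differentiableAt_const 1).sub (h1.norm_sq ℝ)
      exact (differentiableAt_const _).fun_div h2 (hpos u).ne'
    have h1 := hc.hasDerivAt.fun_mul (hasDerivAt_radicalNumer (hmd u) k μ z)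
    rw [hu, mul_zero, zero_add] at h1
    simp_rw [← hG] at h1
    have h2 : HasDerivAt (fun v => radicalFn (T v) (chart C r z)) 0 u ↔
        (conj (m' u) * (z + k * μ / 2)).re = 0 := by
      constructor
      · intro h3
        have h4 := h1.unique h3
        have h5 := (div_pos (pow_pos hr 2) (hpos u)).ne'
        exact (mul_eq_zero.1 (neg_eq_zero.1 ((mul_eq_zero.1 h4).resolve_left h5))).resolve_left
          (by positivity)
      · intro h3
        rw [h3] at h1
        simpa using h1
    rw [h2]
    have h3 : conj (m' u) * m u + conj (m u) * m' u = 0 := by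
      have h4 : HasDerivAt (fun t => conj (m t)) (conj (m' u)) u :=
        Complex.conjCLE.toContinuousLinearMap.hasFDerivAt.comp_hasDerivAt u (hmd u)
      have h5 := h4.fun_mul (hmd u)
      have h6 : (fun t => conj (m t) * m t) = fun _ => 1 := by
        funext t
        rw [mul_comm, mul_conj_of_norm_eq_one (hm t)]
      rw [h6] at h5
      exact h5.unique (hasDerivAt_const u 1)
    have hmm := mul_conj_of_norm_eq_one (hm u)
    -- As `|m| = 1`, the velocity `m'` is a nonzero imaginary multiple of `m`; so `Re(m̄' Y) = 0`
    -- amounts to `Im(m̄ Y) = 0`, free of the parametrization.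
    have h4 : (conj (m u) * m' u).re = 0 := by
      have := congrArg Complex.re h3
      simp only [Complex.add_re, Complex.mul_re, Complex.conj_re, Complex.conj_im,
        Complex.zero_re] at this ⊢
      linarith
    have h5 : conj (m u) * m' u ≠ 0 := by
      refine mul_ne_zero ?_ (hm0 u)
      rw [Ne, map_eq_zero]
      exact ne_zero_of_norm_eq_one (hm u)
    have h6 : (conj (m u) * m' u).im ≠ 0 := fun h => h5 (Complex.ext h4 h)
    have h7 : conj (m' u) * (z + k * μ / 2) =
        conj (conj (m u) * m' u) * (conj (m u) * (z + k * μ / 2)) := by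
      rw [map_mul, Complex.conj_conj]
      linear_combination -(conj (m' u) * (z + k * μ / 2)) * hmm
    rw [h7, Complex.mul_re, Complex.conj_re, Complex.conj_im, h4]
    simp [h6, -Complex.mul_im]
  constructor
  · rintro ⟨u, h1, h2⟩
    have h1' : radicalFn (T u) (chart C r z) = 0 := h1
    rw [hG, mul_eq_zero] at h1'
    have h3 := h1'.resolve_left (div_pos (pow_pos hr 2) (hpos u)).ne'
    exact ⟨m u, hm u, h3, (hderiv u h3).1 h2⟩
  · rintro ⟨m₀, hm₀, h1, h2⟩
    obtain ⟨u, rfl⟩ := hsurj m₀ hm₀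
    refine ⟨u, ?_, (hderiv u h1).2 h2⟩
    change radicalFn (T u) (chart C r z) = 0
    rw [hG, h1, mul_zero]

/-! ### Lines, parabola and ellipse in the complex coordinate -/

/-- The line of the points whose coordinate `z` satisfies `Re (z * conj μ) = c`. -/
noncomputable def chartLine (C : Plane) (r : ℝ) (μ : ℂ) (c : ℝ) : AffineSubspace ℝ Plane :=
  AffineSubspace.mk' (chart C r (c * μ)) (ℝ ∙ planeIso (μ * Complex.I))

variable {C : Plane} {r : ℝ} {μ : ℂ}

theorem isLine_chartLine (hμ : ‖μ‖ = 1) (c : ℝ) : IsLine (chartLine C r μ c) := by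
  refine ⟨AffineSubspace.mk'_nonempty _ _, ?_⟩
  rw [chartLine, AffineSubspace.direction_mk']
  apply finrank_span_singleton
  rw [Ne, LinearIsometryEquiv.map_eq_zero_iff]
  exact mul_ne_zero (ne_zero_of_norm_eq_one hμ) Complex.I_ne_zero

theorem chart_mem_chartLine_iff (hr : 0 < r) (hμ : ‖μ‖ = 1) (c : ℝ) (z : ℂ) :
    chart C r z ∈ chartLine C r μ c ↔ (z * conj μ).re = c := by
  have hμμ := mul_conj_of_norm_eq_one hμ
  rw [chartLine, AffineSubspace.mem_mk', vsub_eq_sub, chart_sub_chart,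
    Submodule.mem_span_singleton]
  constructor
  · rintro ⟨t, ht⟩
    rw [← map_smul, ← map_smul] at ht
    have h1 := planeIso.injective ht
    rw [Complex.real_smul, Complex.real_smul] at h1
    have h2 : (r : ℂ) * (z * conj μ) = r * c + t * Complex.I := by
      linear_combination (r * c + t * Complex.I) * hμμ - conj μ * h1
    have h3 := congrArg Complex.re h2
    simp [-Complex.mul_re] at h3
    rw [Complex.re_ofReal_mul] at h3
    simpa [hr.ne'] using h3
  · intro h
    refine ⟨r * (z * conj μ).im, ?_⟩
    rw [← map_smul, ← map_smul]
    congr 1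
    have h1 := Complex.re_add_im (z * conj μ)
    rw [h] at h1
    rw [Complex.real_smul, Complex.real_smul]
    push_cast
    linear_combination r * μ * h1 + r * z * hμμ

theorem chartLine_parallel (c c' : ℝ) : chartLine C r μ c ∥ chartLine C r μ c' := by
  rw [AffineSubspace.parallel_iff_direction_eq_and_eq_bot_iff_eq_bot]
  refine ⟨by rw [chartLine, chartLine, AffineSubspace.direction_mk',
    AffineSubspace.direction_mk'], ?_⟩
  have h : ∀ d, chartLine C r μ d ≠ ⊥ := fun d =>
    (AffineSubspace.nonempty_iff_ne_bot _).1 (AffineSubspace.mk'_nonempty _ _)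
  simp [h]

theorem infDist_chartLine (hr : 0 < r) (hμ : ‖μ‖ = 1) (c : ℝ) (z : ℂ) :
    Metric.infDist (chart C r z) (chartLine C r μ c : Set Plane) =
      r * |(z * conj μ).re - c| := by
  have hμμ := mul_conj_of_norm_eq_one hμ
  apply le_antisymm
  · have h1 : chart C r (z - ((z * conj μ).re - c : ℝ) * μ) ∈
        (chartLine C r μ c : Set Plane) := by
      rw [SetLike.mem_coe, chart_mem_chartLine_iff hr hμ, sub_mul, mul_assoc, hμμ, mul_one,
        Complex.sub_re, Complex.ofReal_re]
      ring
    refine (Metric.infDist_le_dist_of_mem h1).trans ?_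
    rw [dist_chart hr, sub_sub_cancel, norm_mul, hμ, mul_one, Complex.norm_real, Real.norm_eq_abs]
  · refine (Metric.le_infDist (isLine_chartLine hμ c).1).2 ?_
    intro P hP
    obtain ⟨x, rfl⟩ := chart_surjective (C := C) hr P
    rw [SetLike.mem_coe, chart_mem_chartLine_iff hr hμ] at hP
    rw [dist_chart hr, ← hP, ← Complex.sub_re, ← sub_mul]
    refine mul_le_mul_of_nonneg_left ((Complex.abs_re_le_norm _).trans ?_) hr.le
    rw [norm_mul, RCLike.norm_conj, hμ, mul_one]

theorem isParabola_of_mem_iff {k : ℝ} (hr : 0 < r) (hk : 0 < k) (hμ : ‖μ‖ = 1) {S : Set Plane}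
    (hS : ∀ z, chart C r z ∈ S ↔
      ‖z + k * μ / 2‖ = |((z + k * μ / 2) * conj μ).re + 3 / (4 * k)|) :
    IsParabola S (chart C r (-(k * μ / 2))) (chartLine C r μ (-(3 / (4 * k)) - k / 2)) := by
  have hμμ := mul_conj_of_norm_eq_one hμ
  have h1 : ∀ z, ((z + k * μ / 2) * conj μ).re = (z * conj μ).re + k / 2 := by
    intro z
    have : (z + k * μ / 2) * conj μ = z * conj μ + ((k / 2 : ℝ) : ℂ) := by
      push_cast
      linear_combination k / 2 * hμμ
    rw [this, Complex.add_re, Complex.ofReal_re]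
  refine ⟨isLine_chartLine hμ _, ?_, ?_⟩
  · rw [chart_mem_chartLine_iff hr hμ]
    intro h
    have h2 := h1 (-(k * μ / 2))
    rw [neg_add_cancel, zero_mul, Complex.zero_re, h] at h2
    have : 0 < 3 / (4 * k) := by positivity
    linarith
  · ext P
    obtain ⟨z, rfl⟩ := chart_surjective (C := C) hr P
    rw [hS, Set.mem_ofPred_eq, dist_chart hr, infDist_chartLine hr hμ, mul_right_inj' hr.ne', h1,
      sub_neg_eq_add]
    have : (z * conj μ).re - (-(3 / (4 * k)) - k / 2) = (z * conj μ).re + k / 2 + 3 / (4 * k) := by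
      ring
    rw [this]

theorem chart_mem_axis_iff (hr : 0 < r) (hμ : ‖μ‖ = 1) (c f : ℝ) (z : ℂ) :
    chart C r z ∈ parabolaAxis (chart C r (f * μ)) (chartLine C r μ c) ↔ (z * conj μ).im = 0 := by
  have hμμ := mul_conj_of_norm_eq_one hμ
  rw [parabolaAxis, AffineSubspace.mem_mk', vsub_eq_sub, chart_sub_chart, chartLine,
    AffineSubspace.direction_mk', Submodule.mem_orthogonal_singleton_iff_inner_left,
    inner_smul_left, inner_planeIso]
  have : (z - f * μ) * conj (μ * Complex.I) = (z * conj μ - f) * -Complex.I := by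
    rw [map_mul, Complex.conj_I]
    linear_combination f * Complex.I * hμμ
  rw [this]
  generalize z * conj μ = x
  simp [hr.ne']

theorem chart_mem_line_iff (hr : 0 < r) (hμ : ‖μ‖ = 1) {f f' : ℝ} (hf : f ≠ f') (z : ℂ) :
    chart C r z ∈ line[ℝ, chart C r (f * μ), chart C r (f' * μ)] ↔ (z * conj μ).im = 0 := by
  have hμμ := mul_conj_of_norm_eq_one hμ
  have hlm : ∀ t : ℝ, AffineMap.lineMap (chart C r (f * μ)) (chart C r (f' * μ)) t =
      chart C r (((f + t * (f' - f) : ℝ) : ℂ) * μ) := by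
    intro t
    rw [AffineMap.lineMap_apply, vsub_eq_sub, chart_sub_chart, vadd_eq_add, ← map_smul, ← map_smul,
      chart, chart, add_left_comm, ← map_smul, ← map_add, ← map_smul]
    congr 2
    simp only [Complex.real_smul]
    push_cast
    ring
  constructor
  · intro h
    obtain ⟨t, ht⟩ := (mem_affineSpan_pair_iff_exists_lineMap_eq).1 h
    rw [hlm] at ht
    rw [← chart_injective hr ht, mul_assoc, hμμ, mul_one, Complex.ofReal_im]
  · intro h
    rw [mem_affineSpan_pair_iff_exists_lineMap_eq]
    refine ⟨((z * conj μ).re - f) / (f' - f), ?_⟩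
    rw [hlm]
    congr 1
    rw [div_mul_cancel₀ _ (sub_ne_zero.2 hf.symm), add_sub_cancel]
    have h1 := Complex.re_add_im (z * conj μ)
    rw [h, Complex.ofReal_zero, zero_mul, add_zero] at h1
    rw [h1]
    linear_combination z * hμμ

theorem parabolaAxis_eq_line (hr : 0 < r) (hμ : ‖μ‖ = 1) (c f₀ : ℝ) {f f' : ℝ} (hf : f ≠ f') :
    parabolaAxis (chart C r (f₀ * μ)) (chartLine C r μ c) =
      line[ℝ, chart C r (f * μ), chart C r (f' * μ)] := by
  ext P
  obtain ⟨z, rfl⟩ := chart_surjective (C := C) hr P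
  rw [chart_mem_axis_iff hr hμ, chart_mem_line_iff hr hμ hf]

theorem norm_sub_ofReal_mul (hμ : ‖μ‖ = 1) (o : ℂ) (f : ℝ) :
    ‖o - f * μ‖ ^ 2 = ‖o‖ ^ 2 - 2 * f * (o * conj μ).re + f ^ 2 := by
  rw [← Complex.normSq_eq_norm_sq, Complex.normSq_sub, map_mul (starRingEnd ℂ), Complex.conj_ofReal,
    mul_left_comm, Complex.re_ofReal_mul, Complex.normSq_mul, Complex.normSq_ofReal,
    Complex.normSq_eq_norm_sq, Complex.normSq_eq_norm_sq, hμ]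
  ring

/-- An ellipse with a vertex at the origin in terms of its focal distances. -/
theorem norm_add_norm_eq_iff {k : ℝ} (hk : 0 < k) (hk' : 2 * k < 1) (hμ : ‖μ‖ = 1) (o : ℂ) :
    ‖o - (2 * k / (1 - 2 * k) : ℝ) * μ‖ + ‖o - (2 * k / (1 + 2 * k) : ℝ) * μ‖
      = 2 * (2 * k / (1 - 4 * k ^ 2)) ↔
      ‖o‖ ^ 2 = (2 + 2 * k * (o * conj μ).re) * (2 * k * (o * conj μ).re) := by
  have e1 := norm_sub_ofReal_mul hμ o (2 * k / (1 - 2 * k))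
  have e2 := norm_sub_ofReal_mul hμ o (2 * k / (1 + 2 * k))
  have n1 := norm_nonneg (o - (2 * k / (1 - 2 * k) : ℝ) * μ)
  have n2 := norm_nonneg (o - (2 * k / (1 + 2 * k) : ℝ) * μ)
  have ht : (o * conj μ).re ^ 2 ≤ ‖o‖ ^ 2 := by
    rw [sq_le_sq, abs_norm]
    refine (Complex.abs_re_le_norm _).trans ?_
    rw [norm_mul, RCLike.norm_conj, hμ, mul_one]
  set d1 := ‖o - (2 * k / (1 - 2 * k) : ℝ) * μ‖
  set d2 := ‖o - (2 * k / (1 + 2 * k) : ℝ) * μ‖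
  set t := (o * conj μ).re
  set R := ‖o‖ ^ 2
  have p1 : 0 < 1 - 2 * k := by linarith
  have p2 : 0 < 1 + 2 * k := by linarith
  have p3 : 1 - 4 * k ^ 2 = (1 - 2 * k) * (1 + 2 * k) := by ring
  rw [p3]
  -- `A` is the semi-major axis and, the origin being a vertex, also the abscissa of the center
  -- along `μ`. The eccentricity is `2k`, so the foci are at `A(1 ± 2k)` and the focal distances are
  -- `A ∓ 2k(t - A)`.
  set A := 2 * k / ((1 - 2 * k) * (1 + 2 * k)) with hA
  have hApos : 0 < A := by positivity
  have f1 : 2 * k / (1 - 2 * k) = A * (1 + 2 * k) := by rw [hA]; field_simp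
  have f2 : 2 * k / (1 + 2 * k) = A * (1 - 2 * k) := by rw [hA]; field_simp
  have hAk : A * (1 - 4 * k ^ 2) = 2 * k := by rw [hA, p3]; field_simp
  clear_value A
  rw [f1] at e1
  rw [f2] at e2
  constructor
  · intro h
    have g1 : d1 ^ 2 - d2 ^ 2 = -(8 * k * A) * (t - A) := by
      rw [e1, e2]; ring
    have g2 : d1 - d2 = -(4 * k) * (t - A) := by
      have : (d1 - d2) * (2 * A) = -(8 * k * A) * (t - A) := by rw [← h, ← g1]; ring
      have h3 : (2 * A) * (d1 - d2) = (2 * A) * (-(4 * k) * (t - A)) := by linarith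
      exact mul_left_cancel₀ (by positivity) h3
    have g3 : d1 = A - 2 * k * (t - A) := by linarith
    rw [g3] at e1
    linear_combination -e1 + 2 * t * hAk
  · intro h
    have hR : R = 4 * k * t + 4 * k ^ 2 * t ^ 2 := by rw [h]; ring
    have g1 : d1 ^ 2 = (A - 2 * k * (t - A)) ^ 2 := by
      rw [e1, hR]
      linear_combination -(2 * t) * hAk
    have g2 : d2 ^ 2 = (A + 2 * k * (t - A)) ^ 2 := by
      rw [e2, hR]
      linear_combination -(2 * t) * hAk
    -- This bound makes both linear expressions for the focal distances nonnegative, as extracting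
    -- the square roots requires.
    have ht2 : (t - A) ^ 2 ≤ A ^ 2 := by
      have h1 : t ^ 2 * (1 - 4 * k ^ 2) ≤ 4 * k * t := by
        rw [hR] at ht; linarith
      have h2 : 0 < 1 - 4 * k ^ 2 := by rw [p3]; positivity
      have h3 : (1 - 4 * k ^ 2) * (t ^ 2 - 2 * A * t) ≤ 0 := by
        have : (1 - 4 * k ^ 2) * (t ^ 2 - 2 * A * t) = t ^ 2 * (1 - 4 * k ^ 2) - 4 * k * t := by
          linear_combination -2 * t * hAk
        linarith
      have h4 := nonpos_of_mul_nonpos_right h3 h2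
      linarith
    obtain ⟨h5, h6⟩ := abs_le_of_sq_le_sq' ht2 hApos.le
    have g3 : d1 = A - 2 * k * (t - A) := (sq_eq_sq₀ n1 (by nlinarith)).1 g1
    have g4 : d2 = A + 2 * k * (t - A) := (sq_eq_sq₀ n2 (by nlinarith)).1 g2
    linarith

/-! ### Existence of a regular parametrization -/

/-- One contact point determines the product, hence the sum, hence the other two points up to
exchange. -/
theorem IsPonceletTriple.range_contactVertex_eq {k : ℝ} {μ : ℂ} {w w' : Fin 3 → ℂ}
    (h : IsPonceletTriple k μ w) (h' : IsPonceletTriple k μ w') (hk : 0 < k) (hk' : 2 * k < 1)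
    (hμ : ‖μ‖ = 1) (h0 : w 0 = w' 0) :
    Set.range (contactVertex w) = Set.range (contactVertex w') := by
  have hp : w 0 * w 1 * w 2 = w' 0 * w' 1 * w' 2 := by
    rw [h.prod_eq hk hk' hμ, h'.prod_eq hk hk' hμ, h0]
  have hs : w 0 + w 1 + w 2 = w' 0 + w' 1 + w' 2 := by rw [h.sum_eq, h'.sum_eq, hp]
  have hs' : w 1 + w 2 = w' 1 + w' 2 := by linear_combination hs - h0
  have hp' : w 1 * w 2 = w' 1 * w' 2 := by
    refine mul_left_cancel₀ (ne_zero_of_norm_eq_one (h.norm_eq_one 0)) ?_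
    linear_combination hp - w' 1 * w' 2 * h0
  have hor : (w 1 - w' 1) * (w 1 - w' 2) = 0 := by linear_combination w 1 * hs' - hp'
  rcases mul_eq_zero.1 hor with h1 | h1
  · have e1 : w 1 = w' 1 := sub_eq_zero.1 h1
    have e2 : w 2 = w' 2 := by linear_combination hs' - h1
    have : w = w' := by
      funext i
      fin_cases i
      · exact h0
      · exact e1
      · exact e2
    rw [this]
  · have e1 : w 1 = w' 2 := sub_eq_zero.1 h1
    have e2 : w 2 = w' 1 := by linear_combination hs' - h1
    have h3 : contactVertex w = contactVertex w' ∘ Equiv.swap 1 2 := by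
      funext i
      fin_cases i
      · change tangentMeet (w 1) (w 2) = tangentMeet (w' 1) (w' 2)
        rw [e1, e2, tangentMeet_comm]
      · change tangentMeet (w 2) (w 0) = tangentMeet (w' 0) (w' 1)
        rw [h0, e2, tangentMeet_comm]
      · change tangentMeet (w 0) (w 1) = tangentMeet (w' 2) (w' 0)
        rw [h0, e1, tangentMeet_comm]
    rw [h3, (Equiv.swap 1 2).surjective.range_comp]

theorem contDiff_chart_contactVertex {w : ℝ → Fin 3 → ℂ} (hw : ∀ i, ContDiff ℝ 1 fun t => w t i)
    (hc : ∀ t, IsContactTriple (w t)) (C : Plane) (r : ℝ) (i : Fin 3) :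
    ContDiff ℝ 1 fun t => chart C r (contactVertex (w t) i) := by
  have h1 : ContDiff ℝ 1 fun t => contactVertex (w t) i := by
    simp only [contactVertex, tangentMeet, div_eq_mul_inv]
    exact ((contDiff_const.mul (hw _)).mul (hw _)).mul
      (((hw _).add (hw _)).inv fun t => (hc t).add_ne_zero i)
  have h2 : ContDiff ℝ 1 fun t => planeIso (contactVertex (w t) i) :=
    planeIso.toContinuousLinearEquiv.contDiff.comp h1
  exact contDiff_const.add (h2.const_smul r)

/-- A stationary point lying on the rotating tangent at `w` can only be its point of contact. -/
theorem eq_of_hasDerivAt_zero {V w : ℝ → ℂ} {u : ℝ} (hV : HasDerivAt V 0 u)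
    (hw : HasDerivAt w (w u * Complex.I) u) (hn : ‖w u‖ = 1)
    (h : ∀ t, (V t * conj (w t)).re = 1) : V u = w u := by
  have hconj : ∀ {f : ℝ → ℂ} {x : ℂ}, HasDerivAt f x u → HasDerivAt (fun t => conj (f t)) (conj x) u :=
    fun hf => Complex.conjCLE.toContinuousLinearMap.hasFDerivAt.comp_hasDerivAt u hf
  have h1 : ∀ t, V t * conj (w t) + conj (V t) * w t = 2 := by
    intro t
    have := Complex.add_conj (V t * conj (w t))
    rw [h, map_mul, Complex.conj_conj] at this
    rw [this]
    norm_num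
  have h2 := (hV.fun_mul (hconj hw)).fun_add ((hconj hV).fun_mul hw)
  simp_rw [h1] at h2
  have h3 := h2.unique (hasDerivAt_const u 2)
  rw [map_mul, Complex.conj_I, map_zero] at h3
  have h4 : V u * conj (w u) = conj (V u) * w u := by
    refine mul_right_cancel₀ Complex.I_ne_zero ?_
    linear_combination -h3
  have h5 := h1 u
  have h6 : V u * conj (w u) = 1 := by linear_combination (h5 + h4) / 2
  linear_combination w u * h6 - V u * mul_conj_of_norm_eq_one hn

theorem exists_isRegularParam {a b : ℝ} {C : Plane} {r k : ℝ} {μ : ℂ} (hr : 0 < r) (hk : 0 < k)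
    (hk' : 2 * k < 1) (hμ : ‖μ‖ = 1)
    (hE : ∀ z, chart C r z ∈ outerEllipse a b ↔ OnConic k μ z) :
    ∃ T, IsRegularParam (ponceletFamily a b C r) T := by
  have hn : ∀ t : ℝ, ‖Complex.exp (t * Complex.I)‖ = 1 := Complex.norm_exp_ofReal_mul_I
  have hw := fun t : ℝ => isPonceletTriple_ponceletTriple hk hk' hμ (hn t)
  have hc := fun t => (hw t).isContactTriple hk hk' hμ
  let T : ℝ → Affine.Triangle ℝ Plane := fun t => ⟨_, (hc t).affineIndependent C hr⟩
  have hT : ∀ t i, (T t).points i =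
      chart C r (contactVertex (ponceletTriple k μ (Complex.exp (t * Complex.I))) i) :=
    fun _ _ => rfl
  refine ⟨T, fun t => (mem_ponceletFamily_iff hr hk hk' hμ hE _).2 ⟨_, hw t, hT t⟩,
    contDiff_chart_contactVertex (contDiff_ponceletTriple hk hk' hμ) hc C r, fun u => ?_,
    fun S hS => ?_⟩
  · by_contra! hreg
    have hV : ∀ i, HasDerivAt (fun t : ℝ =>
        contactVertex (ponceletTriple k μ (Complex.exp (t * Complex.I))) i) 0 u := by
      intro i
      have h1 : HasDerivAt (fun t => (T t).points i) 0 u := by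
        rw [← hreg i]
        exact ((contDiff_chart_contactVertex (contDiff_ponceletTriple hk hk' hμ) hc C r
          i).differentiable one_ne_zero u).hasDerivAt
      simp_rw [hT] at h1
      simpa using hasDerivAt_of_hasDerivAt_chart hr.ne' h1
    have hexp : HasDerivAt (fun t : ℝ => Complex.exp (t * Complex.I))
        (Complex.exp (u * Complex.I) * Complex.I) u := by
      have h1 : HasDerivAt (fun t : ℝ => (t : ℂ) * Complex.I) Complex.I u := by
        simpa using (Complex.ofRealCLM.hasDerivAt (x := u)).mul_const Complex.I
      exact h1.cexp
    -- Were all vertices stationary, both vertices on the tangent at `exp(iu)` would coincide with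
    -- its contact point.
    have h1 : ∀ j : Fin 3, j ≠ 0 → contactVertex (ponceletTriple k μ (Complex.exp
        (u * Complex.I))) j = Complex.exp (u * Complex.I) := fun j hj =>
      eq_of_hasDerivAt_zero (hV j) hexp (hn u) fun t => (hc t).re_contactVertex_of_ne hj
    have h2 : (T u).points 1 = (T u).points 2 := by
      rw [hT, hT, h1 1 (by decide), h1 2 (by decide)]
    exact absurd ((T u).independent.injective h2) (by decide)
  · obtain ⟨w, hwS, hS'⟩ := (mem_ponceletFamily_iff hr hk hk' hμ hE S).1 hS
    have hexp : Complex.exp ((w 0).arg * Complex.I) = w 0 := by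
      have := Complex.norm_mul_exp_arg_mul_I (w 0)
      rwa [hwS.norm_eq_one, Complex.ofReal_one, one_mul] at this
    refine ⟨(w 0).arg, ?_⟩
    have h1 := (hw (w 0).arg).range_contactVertex_eq hwS hk hk' hμ hexp
    have h2 : (T (w 0).arg).points = chart C r ∘
        contactVertex (ponceletTriple k μ (Complex.exp ((w 0).arg * Complex.I))) :=
      funext (hT _)
    have h3 : S.points = chart C r ∘ contactVertex w := funext hS'
    rw [h2, h3, Set.range_comp, Set.range_comp, h1]

/-! ### Loci of the circumcenter and of X₃₆ -/

theorem re_ofReal_mul_mul_conj (c : ℝ) (x μ : ℂ) :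
    ((c : ℂ) * x * conj μ).re = c * (x * conj μ).re := by
  rw [mul_assoc, Complex.re_ofReal_mul]

/-- The right side is the equation of the circle of radius `k` about `-kμ`, through the origin. -/
theorem exists_unit_iff {k : ℝ} {μ σ : ℂ} (hk : 0 < k) (hμ : ‖μ‖ = 1) :
    (∃ m : ℂ, ‖m‖ = 1 ∧ σ = k * (m - μ)) ↔ ‖σ‖ ^ 2 = -(2 * k * (σ * conj μ).re) := by
  have hkc : (k : ℂ) ≠ 0 := by exact_mod_cast hk.ne'
  have key : ∀ m : ℂ, ‖k * (m - μ)‖ ^ 2 + 2 * k * (k * (m - μ) * conj μ).re =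
      k ^ 2 * (‖m‖ ^ 2 - 1) := by
    intro m
    have h1 := re_sq_add_im_sq hμ
    rw [← Complex.normSq_eq_norm_sq, ← Complex.normSq_eq_norm_sq,
      re_ofReal_mul_mul_conj, map_mul, Complex.normSq_ofReal, Complex.normSq_apply,
      Complex.normSq_apply]
    simp only [Complex.mul_re, Complex.sub_re, Complex.sub_im, Complex.conj_re, Complex.conj_im]
    linear_combination -(k ^ 2) * h1
  constructor
  · rintro ⟨m, hm, rfl⟩
    have := key m
    rw [hm] at this
    linarith
  · intro h
    have h1 : σ = k * (σ / k + μ - μ) := by field_simp; ring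
    refine ⟨σ / k + μ, ?_, h1⟩
    have h2 := key (σ / k + μ)
    rw [← h1, h] at h2
    have h3 : ‖σ / k + μ‖ ^ 2 - 1 = 0 := by
      rcases mul_eq_zero.1 (show k ^ 2 * (‖σ / k + μ‖ ^ 2 - 1) = 0 by linarith) with h | h
      · exact absurd h (by positivity)
      · exact h
    exact (pow_eq_one_iff_of_nonneg (norm_nonneg _) two_ne_zero).1 (by linarith)

theorem IsContactTriple.incenter_eq {w : Fin 3 → ℂ} (h : IsContactTriple w) {C : Plane}
    {r : ℝ} (hr : 0 < r) {T : Affine.Triangle ℝ Plane}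
    (hT : ∀ i, T.points i = chart C r (contactVertex w i)) : T.incenter = C := by
  rw [← T.insphere_center, h.insphere_eq hr hT]

/-- Centers and circumradii of the triangles of the family. -/
theorem exists_mem_ponceletFamily_iff {a b : ℝ} {C : Plane} {r k : ℝ} {μ : ℂ} (hr : 0 < r)
    (hk : 0 < k) (hk' : 2 * k < 1) (hμ : ‖μ‖ = 1)
    (hE : ∀ z, chart C r z ∈ outerEllipse a b ↔ OnConic k μ z) (P : Plane → Plane → ℝ → Prop) :
    (∃ T ∈ ponceletFamily a b C r, P T.incenter T.circumcenter T.circumradius) ↔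
      ∃ σ : ℂ, ‖σ‖ ^ 2 = -(2 * k * (σ * conj μ).re) ∧
        P C (chart C r (-(2 * σ / ((1 - ‖σ‖ ^ 2 : ℝ) : ℂ)))) (r * (2 / (1 - ‖σ‖ ^ 2))) := by
  constructor
  · rintro ⟨T, hT, hP⟩
    obtain ⟨w, hw, hTw⟩ := (mem_ponceletFamily_iff hr hk hk' hμ hE T).1 hT
    have hc := hw.isContactTriple hk hk' hμ
    obtain ⟨h1, h2⟩ := hc.circumcenter_and_circumradius hr hTw
    rw [h1, h2, hc.incenter_eq hr hTw] at hP
    exact ⟨_, (exists_unit_iff hk hμ).1 ⟨_, hw.norm_prod, hw.sum_eq⟩, hP⟩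
  · rintro ⟨σ, hσ, hP⟩
    obtain ⟨m, hm, hσm⟩ := (exists_unit_iff hk hμ).2 hσ
    obtain ⟨v, hv, hvm⟩ := exists_mul_contactPhase_sq_eq hk hk' hμ hm
    have hw := isPonceletTriple_ponceletTriple hk hk' hμ hv
    have hc := hw.isContactTriple hk hk' hμ
    let T : Affine.Triangle ℝ Plane := ⟨_, hc.affineIndependent C hr⟩
    have hT : ∀ i, T.points i = chart C r (contactVertex (ponceletTriple k μ v) i) := fun _ => rfl
    refine ⟨T, (mem_ponceletFamily_iff hr hk hk' hμ hE T).2 ⟨_, hw, hT⟩, ?_⟩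
    obtain ⟨h1, h2⟩ := hc.circumcenter_and_circumradius hr hT
    have h3 : ponceletTriple k μ v 0 + ponceletTriple k μ v 1 + ponceletTriple k μ v 2 = σ := by
      rw [hw.sum_eq, hw.prod_eq hk hk' hμ, hσm, ← hvm]
      rfl
    rw [h1, h2, hc.incenter_eq hr hT, h3]
    exact hP

theorem norm_lt_one_of_sq_eq {k : ℝ} {μ σ : ℂ} (hk : 0 < k) (hk' : 2 * k < 1) (hμ : ‖μ‖ = 1)
    (h : ‖σ‖ ^ 2 = -(2 * k * (σ * conj μ).re)) : 0 < 1 - ‖σ‖ ^ 2 := by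
  have h1 := Complex.abs_re_le_norm (σ * conj μ)
  rw [norm_mul, RCLike.norm_conj, hμ, mul_one] at h1
  have h2 := (abs_le.1 h1).1
  have h3 := norm_nonneg σ
  have h4 : ‖σ‖ < 1 := by
    by_contra! h5
    nlinarith
  nlinarith

theorem chart_mem_circumcenterLocus_iff {a b : ℝ} {C : Plane} {r k : ℝ} {μ : ℂ} (hr : 0 < r)
    (hk : 0 < k) (hk' : 2 * k < 1) (hμ : ‖μ‖ = 1)
    (hE : ∀ z, chart C r z ∈ outerEllipse a b ↔ OnConic k μ z) (o : ℂ) :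
    chart C r o ∈ circumcenterLocus (ponceletFamily a b C r) ↔
      ‖o‖ ^ 2 = (2 + 2 * k * (o * conj μ).re) * (2 * k * (o * conj μ).re) := by
  refine (exists_mem_ponceletFamily_iff hr hk hk' hμ hE
    (fun _ O _ => chart C r o = O)).trans ?_
  constructor
  · rintro ⟨σ, hσ, ho⟩
    have hpos := norm_lt_one_of_sq_eq hk hk' hμ hσ
    have ho' : o = ((-(2 / (1 - ‖σ‖ ^ 2)) : ℝ) : ℂ) * σ := by
      rw [chart_injective hr ho]; push_cast; ring
    rw [ho', re_ofReal_mul_mul_conj, norm_mul, Complex.norm_real, Real.norm_eq_abs,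
      mul_pow, sq_abs]
    field_simp
    linear_combination (1 - (2 * k * (σ * conj μ).re)) * hσ
  · intro h
    set t := (o * conj μ).re with ht
    have h1 : t ^ 2 ≤ ‖o‖ ^ 2 := by
      rw [sq_le_sq, abs_norm, ht]
      refine (Complex.abs_re_le_norm _).trans ?_
      rw [norm_mul, RCLike.norm_conj, hμ, mul_one]
    -- From `t² ≤ |o|² = 4kt + 4k²t²` and `2k < 1`.
    have ht0 : 0 ≤ t := by
      by_contra! h2
      have h3 : 0 < t * t := mul_pos_of_neg_of_neg h2 h2
      have h4 : 4 * k ^ 2 < 1 := by nlinarith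
      nlinarith
    have hR : 0 < 2 + 2 * k * t := by positivity
    have hRc : ((2 + 2 * k * t : ℝ) : ℂ) ≠ 0 := by exact_mod_cast hR.ne'
    have hs : ‖((-(1 / (2 + 2 * k * t)) : ℝ) : ℂ) * o‖ ^ 2 = 2 * k * t / (2 + 2 * k * t) := by
      rw [norm_mul, Complex.norm_real, Real.norm_eq_abs, mul_pow, sq_abs, h]
      field_simp
    -- Solving `o = -2σ/(1 - |σ|²)` with `|σ|² = -2k Re(σ μ̄)` gives `1 - |σ|² = 2/(2 + 2kt)`, hence
    -- this `σ`.
    refine ⟨((-(1 / (2 + 2 * k * t)) : ℝ) : ℂ) * o, ?_, ?_⟩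
    · rw [hs, re_ofReal_mul_mul_conj, ← ht]
      field_simp
    · rw [hs]
      have h2 : 1 - 2 * k * t / (2 + 2 * k * t) = 2 / (2 + 2 * k * t) := by field_simp; ring
      rw [h2]
      have h3 : (1 + k * t : ℂ) ≠ 0 := by
        intro h0
        apply hRc
        push_cast
        linear_combination 2 * h0
      congr 1
      push_cast
      field_simp

theorem inversion_chart {C : Plane} {r : ℝ} (hr : 0 < r) (o x : ℂ) (R : ℝ) :
    EuclideanGeometry.inversion (chart C r o) (r * R) (chart C r x) =
      chart C r (o + ((R / ‖x - o‖) ^ 2 : ℝ) * (x - o)) := by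
  rw [EuclideanGeometry.inversion, dist_chart hr, mul_div_mul_left _ _ hr.ne', vsub_eq_sub,
    chart_sub_chart, vadd_eq_add, chart, chart, map_add, ← Complex.real_smul, map_smul, smul_add,
    smul_comm]
  abel

theorem chart_mem_locusX36_iff {a b : ℝ} {C : Plane} {r k : ℝ} {μ : ℂ} (hr : 0 < r)
    (hk : 0 < k) (hk' : 2 * k < 1) (hμ : ‖μ‖ = 1)
    (hE : ∀ z, chart C r z ∈ outerEllipse a b ↔ OnConic k μ z) (z : ℂ) :
    chart C r z ∈ locusX36 (ponceletFamily a b C r) ↔ (z * conj μ).re = -(1 / k) := by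
  refine (exists_mem_ponceletFamily_iff hr hk hk' hμ hE
    (fun I O R => I ≠ O ∧ chart C r z = EuclideanGeometry.inversion O R I)).trans ?_
  have hinv : ∀ σ : ℂ, σ ≠ 0 → 0 < 1 - ‖σ‖ ^ 2 → EuclideanGeometry.inversion
      (chart C r (-(2 * σ / ((1 - ‖σ‖ ^ 2 : ℝ) : ℂ)))) (r * (2 / (1 - ‖σ‖ ^ 2))) C =
      chart C r (((2 / ‖σ‖ ^ 2 : ℝ) : ℂ) * σ) := by
    intro σ hσ0 hpos
    nth_rw 2 [← chart_zero C r]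
    have h1 : -(2 * σ / ((1 - ‖σ‖ ^ 2 : ℝ) : ℂ)) = ((-(2 / (1 - ‖σ‖ ^ 2)) : ℝ) : ℂ) * σ := by
      push_cast; ring
    rw [inversion_chart hr, h1]
    congr 1
    rw [zero_sub, norm_neg, norm_mul, Complex.norm_real, Real.norm_eq_abs, abs_neg,
      abs_of_pos (by positivity), div_mul_cancel_left₀ (by positivity), mul_neg, ← mul_assoc,
      ← Complex.ofReal_mul, ← sub_eq_add_neg, ← sub_mul, ← Complex.ofReal_sub]
    congr 2
    have := norm_ne_zero_iff.2 hσ0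
    field_simp
    ring
  constructor
  · rintro ⟨σ, hσ, hne, hz⟩
    have hpos := norm_lt_one_of_sq_eq hk hk' hμ hσ
    have hσ0 : σ ≠ 0 := by
      rintro rfl
      apply hne
      simp [chart_zero]
    rw [hinv σ hσ0 hpos] at hz
    rw [chart_injective hr hz, re_ofReal_mul_mul_conj]
    have := norm_ne_zero_iff.2 hσ0
    field_simp
    linear_combination hσ
  · intro h
    have hz0 : z ≠ 0 := by
      rintro rfl
      rw [zero_mul, Complex.zero_re] at h
      have : 0 < 1 / k := by positivity
      linarith
    have hzn := norm_ne_zero_iff.2 hz0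
    have hzn' : (‖z‖ : ℂ) ≠ 0 := by exact_mod_cast hzn
    -- The map `σ ↦ 2σ/|σ|²` is an involution, so the preimage of `z` is `2z/|z|²`.
    have hs : ‖((2 / ‖z‖ ^ 2 : ℝ) : ℂ) * z‖ ^ 2 = 4 / ‖z‖ ^ 2 := by
      rw [norm_mul, Complex.norm_real, Real.norm_eq_abs, mul_pow, sq_abs]
      field_simp
      norm_num
    have hσ : ‖((2 / ‖z‖ ^ 2 : ℝ) : ℂ) * z‖ ^ 2 =
        -(2 * k * (((2 / ‖z‖ ^ 2 : ℝ) : ℂ) * z * conj μ).re) := by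
      rw [hs, re_ofReal_mul_mul_conj, h]
      field_simp
      norm_num
    have hpos := norm_lt_one_of_sq_eq hk hk' hμ hσ
    have hσ0 : ((2 / ‖z‖ ^ 2 : ℝ) : ℂ) * z ≠ 0 := by
      refine mul_ne_zero ?_ hz0
      have : 2 / ‖z‖ ^ 2 ≠ 0 := by positivity
      exact_mod_cast this
    refine ⟨_, hσ, ?_, ?_⟩
    · intro h1
      nth_rw 1 [← chart_zero C r] at h1
      have h2 := chart_injective hr h1
      have hpos' : ((1 - ‖((2 / ‖z‖ ^ 2 : ℝ) : ℂ) * z‖ ^ 2 : ℝ) : ℂ) ≠ 0 := by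
        exact_mod_cast hpos.ne'
      exact (neg_ne_zero.2 (div_ne_zero (mul_ne_zero two_ne_zero hσ0) hpos')) h2.symm
    · rw [hinv _ hσ0 hpos, hs]
      congr 1
      push_cast
      field_simp
      norm_num

end CircularCaustic

/-! ### The theorem -/

theorem mainTheorem11 (a b : ℝ) (hb : 0 < b) (hab : b < a)
    (C : CircularCaustic.Plane) (r : ℝ)
    (hequi : ∃ T ∈ CircularCaustic.ponceletFamily a b C r, T.Equilateral) :
    (∃ T : ℝ → Affine.Triangle ℝ CircularCaustic.Plane,
      CircularCaustic.IsRegularParam (CircularCaustic.ponceletFamily a b C r) T) ∧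
    ∃ (F F₃ F₃' : CircularCaustic.Plane) (a₃ : ℝ)
      (D L₃₆ : AffineSubspace ℝ CircularCaustic.Plane),
      (∀ T : ℝ → Affine.Triangle ℝ CircularCaustic.Plane,
        CircularCaustic.IsRegularParam (CircularCaustic.ponceletFamily a b C r) T →
        CircularCaustic.IsParabola
          (CircularCaustic.envelope (fun u => CircularCaustic.radicalFn (T u))) F D) ∧
      CircularCaustic.IsEllipse
        (CircularCaustic.circumcenterLocus (CircularCaustic.ponceletFamily a b C r)) F₃ F₃' a₃ ∧
      CircularCaustic.parabolaAxis F D = line[ℝ, F₃, F₃'] ∧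
      CircularCaustic.IsLine L₃₆ ∧
      CircularCaustic.locusX36 (CircularCaustic.ponceletFamily a b C r)
        = (L₃₆ : Set CircularCaustic.Plane) ∧
      D ∥ L₃₆ := by
  open CircularCaustic in
  obtain ⟨hr, k, μ, hk, hk', hμ, hE⟩ := exists_onConic hb hab hequi
  have p1 : 0 < 1 - 2 * k := by linarith
  have p3 : 1 - 4 * k ^ 2 = (1 - 2 * k) * (1 + 2 * k) := by ring
  -- The distance between the foci in units of `r`; its positivity makes the ellipse noncircular.
  have hdiff : 2 * k / (1 - 2 * k) - 2 * k / (1 + 2 * k) = 8 * k ^ 2 / (1 - 4 * k ^ 2) := by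
    rw [p3]
    field_simp
    ring
  have p4 : 0 < 1 - 4 * k ^ 2 := by rw [p3]; positivity
  have hdpos : 0 < 8 * k ^ 2 / (1 - 4 * k ^ 2) := by positivity
  have hf : 2 * k / (1 - 2 * k) ≠ 2 * k / (1 + 2 * k) := by
    intro h
    rw [h, sub_self] at hdiff
    exact hdpos.ne hdiff
  refine ⟨exists_isRegularParam hr hk hk' hμ hE, chart C r (-(k * μ / 2)),
    chart C r ((2 * k / (1 - 2 * k) : ℝ) * μ), chart C r ((2 * k / (1 + 2 * k) : ℝ) * μ),
    r * (2 * k / (1 - 4 * k ^ 2)), chartLine C r μ (-(3 / (4 * k)) - k / 2),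
    chartLine C r μ (-(1 / k)), fun T hT => isParabola_of_mem_iff hr hk hμ
      (mem_envelope_iff hr hk hk' hμ hE hT), ⟨?_, ?_, ?_⟩, ?_, isLine_chartLine hμ _, ?_,
    chartLine_parallel _ _⟩
  · intro h
    have h1 := mul_right_cancel₀ (ne_zero_of_norm_eq_one hμ) (chart_injective hr h)
    exact hf (Complex.ofReal_injective h1)
  · rw [dist_chart hr, ← sub_mul, norm_mul, hμ, mul_one, ← Complex.ofReal_sub, Complex.norm_real,
      Real.norm_eq_abs, hdiff, abs_of_pos hdpos, mul_left_comm]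
    refine mul_lt_mul_of_pos_left ?_ hr
    rw [← mul_div_assoc, div_lt_div_iff_of_pos_right p4]
    nlinarith
  · ext P
    obtain ⟨o, rfl⟩ := chart_surjective (C := C) hr P
    rw [chart_mem_circumcenterLocus_iff hr hk hk' hμ hE, ← norm_add_norm_eq_iff hk hk' hμ,
      Set.mem_ofPred_eq, dist_chart hr, dist_chart hr, ← mul_add, mul_left_comm,
      mul_right_inj' hr.ne']
  · have h1 : -(k * μ / 2) = ((-(k / 2) : ℝ) : ℂ) * μ := by push_cast; ring
    rw [h1]
    exact parabolaAxis_eq_line hr hμ _ _ hf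
  · ext P
    obtain ⟨z, rfl⟩ := chart_surjective (C := C) hr P
    rw [SetLike.mem_coe, chart_mem_chartLine_iff hr hμ, chart_mem_locusX36_iff hr hk hk' hμ hE]
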